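/- A basic hoop is an integral commutative residuated lattice $\langle A,\wedge,\vee,\cdot,\to,1\rangle$ satisfying $x(x\to y)\approx x\wedge y$ and $(x\to y)\vee(y\to x)\approx 1$. A BL-algebra is an algebra $\langle A,\wedge,\vee,\cdot,\to,1,0\rangle$ whose $0$-free reduct is a basic hoop with least element $0$. A Wajsberg hoop is an integral commutative residuated lattice satisfying $(x\to y)\to y\approx x\vee y$. An MV-algebra is an algebra in the signature with $0$ whose $0$-free reduct is a Wajsberg hoop with least element $0$. For a totally ordered set $I$ and totally ordered integral commutative residuated lattices $\mathbf A_i$ ($i\in I$) with $A_i\cap A_j=\{1\}$ for $i\ne j$, the ordinal sum $\bigoplus_{i\in I}\mathbf A_i$ is the algebra on $\{1\}\cup\bigcup_{i\in I}A_i$ whose order and operations extend those of each $\mathbf A_i$ and such that, for $i<j$, $x\in A_i\setminus\{1\}$ and $y\in A_j$: $x\le y$ (with $x<y$ if $y \neq 1$), $xy=yx=x$, $x\to y=1$ and $y\to x=x$. A totally ordered basic hoop has finite index if it is isomorphic to an ordinal sum of a finite (possibly empty) family of non-trivial totally ordered Wajsberg hoops. A totally ordered BL-algebra has finite index if its $0$-free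 reduct is isomorphic to an ordinal sum of a finite non-empty family whose first component, with the element corresponding to $0$ designated, is a totally ordered MV-algebra and whose other components are non-trivial totally ordered Wajsberg hoops. (In particular, trivial algebras have finite index.) For a class $\mathbf V$ of basic hoops or of BL-algebras, $\mathbf V_{\mathrm{fc}}$ denotes the class of its totally ordered members of finite index. A span in a class $\mathbf K$ of algebras of the same signature is a pair of embeddings $\varphi_1:\mathbf A\to\mathbf B$, $\varphi_2:\mathbf A\to\mathbf C$ with $\mathbf A,\mathbf B,\mathbf C\in\mathbf K$; an amalgam of it in $\mathbf K$ is a pair of embeddings $\psi_1:\mathbf B\to\mathbf D$, $\psi_2:\mathbf C\to\mathbf D$ with $\mathbf D\in\mathbf K$ and $\psi_1\circ\varphi_1=\psi_2\circ\varphi_2$. The span is essential if $\varphi_2$ is an essential embedding, i.e. every congruence of $\mathbf C$ other than equality identifies two distinct elements of $\varphi_2[A]$. The class $\mathbf K$ has the amalgamation property (respectively, the essential amalgamation property) if every span (respectively, every essential span) in $\mathbf K$ has an amalgam in $\mathbf K$. **Corollary 3.6.** Let $\mathbf V$ be a variety (equational class) of basic hoops, or a variety of BL-algebras. Then $\mathbf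 V$ has the amalgamation property if and only if $\mathbf V_{\mathrm{fc}}$ has the essential amalgamation property. -/

import Mathlib

universe u

namespace BLAmalgamation

open CategoryTheory
open scoped FirstOrder

/-! ### Varieties, congruences, essential embeddings (for algebras in a language `L`)

Languages used below have no relation symbols, so that an `L`-structure is an algebra of signature
`L` and `M ↪[L] N` is the type of injective homomorphisms from `M` to `N`. -/

section General

variable {L : FirstOrder.Language.{0, 0}}

/-- The `L`-algebra `A` satisfies the identity `e.1 ≈ e.2`. -/
def Satisfies (A : Bundled.{u} L.Structure) (e : L.Term ℕ × L.Term ℕ) : Prop :=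
  ∀ v : ℕ → A, e.1.realize v = e.2.realize v

/-- A variety: the class of all `L`-algebras satisfying some set of identities. -/
def IsVariety (V : Set (Bundled.{u} L.Structure)) : Prop :=
  ∃ E : Set (L.Term ℕ × L.Term ℕ),
    ∀ A : Bundled.{u} L.Structure, A ∈ V ↔ ∀ e ∈ E, Satisfies A e

/-- A congruence of an `L`-algebra: an equivalence relation compatible with all operations. -/
structure Congruence (L : FirstOrder.Language.{0, 0}) (M : Type u) [L.Structure M] extends Setoid M where
  compat : ∀ {n : ℕ} (f : L.Functions n) (x y : Fin n → M),
    (∀ i, toSetoid (x i) (y i)) →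
      toSetoid (FirstOrder.Language.Structure.funMap f x) (FirstOrder.Language.Structure.funMap f y)

/-- An embedding `φ : M → N` is essential if every congruence of `N` other than the equality
relation restricts to a congruence of `φ[M]` other than the equality relation. -/
def IsEssential {M N : Type u} [L.Structure M] [L.Structure N] (φ : M ↪[L] N) : Prop :=
  ∀ θ : Congruence L N, (∃ x y : N, x ≠ y ∧ θ.toSetoid x y) →
    ∃ a b : M, φ a ≠ φ b ∧ θ.toSetoid (φ a) (φ b)

/-- The essential amalgamation property: every span `MN : M → N`, `MP : M → P` of embeddings
in `K` for which `MP` is essential has an amalgam in `K`. -/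
def EssentialAmalgamation (K : Set (Bundled.{u} L.Structure)) : Prop :=
  ∀ (M N P : Bundled.{u} L.Structure) (MN : M ↪[L] N) (MP : M ↪[L] P),
    M ∈ K → N ∈ K → P ∈ K → IsEssential MP →
      ∃ (Q : Bundled.{u} L.Structure) (NQ : N ↪[L] Q) (PQ : P ↪[L] Q),
        Q ∈ K ∧ NQ.comp MN = PQ.comp MP

end General

/-! ### The signatures -/

/-- The operation symbols of commutative residuated lattices. -/
inductive HoopFunc : ℕ → Type
  | one : HoopFunc 0
  | inf : HoopFunc 2
  | sup : HoopFunc 2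
  | mul : HoopFunc 2
  | imp : HoopFunc 2

/-- The operation symbols of commutative residuated lattices with a designated least element. -/
inductive BLFunc : ℕ → Type
  | ofHoop {n : ℕ} (f : HoopFunc n) : BLFunc n
  | zero : BLFunc 0

/-- The language `∧, ∨, ·, →, 1`. -/
abbrev hoop : FirstOrder.Language.{0, 0} := ⟨HoopFunc, fun _ => Empty⟩

/-- The language `∧, ∨, ·, →, 1, 0`. -/
abbrev bl : FirstOrder.Language.{0, 0} := ⟨BLFunc, fun _ => Empty⟩

/-- The inclusion of the first signature into the second. -/
def hoopToBL : hoop →ᴸ bl := ⟨fun _ f => BLFunc.ofHoop f, fun _ r => r⟩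

/-- The 0-free reduct. -/
def reduct (A : Bundled.{u} bl.Structure) : Bundled.{u} hoop.Structure :=
  ⟨A, hoopToBL.reduct A⟩

/-- The expansion of an algebra `M` by a designated element `z`, named by the constant `0`. -/
def withZero (M : Bundled.{u} hoop.Structure) (z : M) : Bundled.{u} bl.Structure :=
  ⟨M, { funMap := fun {_} f =>
          match f with
          | BLFunc.ofHoop g => fun x => FirstOrder.Language.Structure.funMap (L := hoop) g x
          | BLFunc.zero => fun _ => z
        RelMap := fun {_} r => Empty.elim r }⟩

section Operations

variable {M : Type u} [hoop.Structure M]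

def one : M := FirstOrder.Language.Structure.funMap (L := hoop) HoopFunc.one ![]
def inf (x y : M) : M := FirstOrder.Language.Structure.funMap (L := hoop) HoopFunc.inf ![x, y]
def sup (x y : M) : M := FirstOrder.Language.Structure.funMap (L := hoop) HoopFunc.sup ![x, y]
def mul (x y : M) : M := FirstOrder.Language.Structure.funMap (L := hoop) HoopFunc.mul ![x, y]
def imp (x y : M) : M := FirstOrder.Language.Structure.funMap (L := hoop) HoopFunc.imp ![x, y]
def le (x y : M) : Prop := inf x y = x

end Operations

/-- The designated element `0`. -/
def zero (A : Bundled.{u} bl.Structure) : reduct A :=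
  FirstOrder.Language.Structure.funMap (L := bl) (M := A) BLFunc.zero ![]

/-! ### The classes of algebras -/

/-- Integral commutative residuated lattices. -/
structure IsICRL (A : Bundled.{u} hoop.Structure) : Prop where
  inf_comm : ∀ x y : A, inf x y = inf y x
  inf_assoc : ∀ x y z : A, inf (inf x y) z = inf x (inf y z)
  sup_comm : ∀ x y : A, sup x y = sup y x
  sup_assoc : ∀ x y z : A, sup (sup x y) z = sup x (sup y z)
  inf_sup_self : ∀ x y : A, inf x (sup x y) = x
  sup_inf_self : ∀ x y : A, sup x (inf x y) = x
  mul_comm : ∀ x y : A, mul x y = mul y x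
  mul_assoc : ∀ x y z : A, mul (mul x y) z = mul x (mul y z)
  one_mul : ∀ x : A, mul one x = x
  residuation : ∀ x y z : A, le (mul x y) z ↔ le x (imp y z)
  le_one : ∀ x : A, le x one

/-- Basic hoops. -/
structure IsBasicHoop (A : Bundled.{u} hoop.Structure) : Prop extends IsICRL A where
  divisible : ∀ x y : A, mul x (imp x y) = inf x y
  prelinear : ∀ x y : A, sup (imp x y) (imp y x) = one

/-- Wajsberg hoops. -/
structure IsWajsbergHoop (A : Bundled.{u} hoop.Structure) : Prop extends IsICRL A where
  wajsberg : ∀ x y : A, imp (imp x y) y = sup x y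

/-- BL-algebras. -/
structure IsBLAlgebra (A : Bundled.{u} bl.Structure) : Prop
    extends IsBasicHoop (reduct A) where
  zero_le : ∀ x : reduct A, le (zero A) x

/-- MV-algebras. -/
structure IsMVAlgebra (A : Bundled.{u} bl.Structure) : Prop
    extends IsWajsbergHoop (reduct A) where
  zero_le : ∀ x : reduct A, le (zero A) x

/-- The lattice order is total. -/
def IsTotallyOrdered (A : Bundled.{u} hoop.Structure) : Prop :=
  ∀ x y : A, le x y ∨ le y x

/-- `A` is (up to isomorphism) the ordinal sum of the algebras `B i`, where `ι i` identifies `B i`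
with a subalgebra of `A`: the subalgebras cover `A`, any two of them meet in `{1}` only, and for
`i < j` the operations between the `i`-th and the `j`-th are those induced by placing the `i`-th
(without `1`) below the `j`-th. The ordinal sum of the empty family is the one-element algebra. -/
structure IsOrdinalSum {I : Type} [LinearOrder I] (B : I → Bundled.{u} hoop.Structure)
    (A : Bundled.{u} hoop.Structure) (ι : ∀ i, B i ↪[hoop] A) : Prop where
  cover : ∀ a : A, a = one ∨ ∃ (i : I) (x : B i), ι i x = a
  disjoint : ∀ i j : I, i ≠ j → ∀ (x : B i) (y : B j), ι i x = ι j y → ι i x = one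
  inf_lt : ∀ i j : I, i < j → ∀ (x : B i) (y : B j), x ≠ one → inf (ι i x) (ι j y) = ι i x
  inf_gt : ∀ i j : I, i < j → ∀ (x : B i) (y : B j), x ≠ one → inf (ι j y) (ι i x) = ι i x
  sup_lt : ∀ i j : I, i < j → ∀ (x : B i) (y : B j), x ≠ one → sup (ι i x) (ι j y) = ι j y
  sup_gt : ∀ i j : I, i < j → ∀ (x : B i) (y : B j), x ≠ one → sup (ι j y) (ι i x) = ι j y
  mul_lt : ∀ i j : I, i < j → ∀ (x : B i) (y : B j), x ≠ one → mul (ι i x) (ι j y) = ι i x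
  mul_gt : ∀ i j : I, i < j → ∀ (x : B i) (y : B j), x ≠ one → mul (ι j y) (ι i x) = ι i x
  imp_lt : ∀ i j : I, i < j → ∀ (x : B i) (y : B j), x ≠ one → imp (ι i x) (ι j y) = one
  imp_gt : ∀ i j : I, i < j → ∀ (x : B i) (y : B j), x ≠ one → imp (ι j y) (ι i x) = ι i x

/-- `A` is the ordinal sum of a (possibly empty) finite family of non-trivial totally ordered
Wajsberg hoops. -/
def HoopFiniteIndex (A : Bundled.{u} hoop.Structure) : Prop :=
  ∃ (I : Type) (_ : LinearOrder I) (_ : Finite I) (B : I → Bundled.{u} hoop.Structure)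
    (ι : ∀ i, B i ↪[hoop] A),
    IsOrdinalSum B A ι ∧
      ∀ i, IsWajsbergHoop (B i) ∧ IsTotallyOrdered (B i) ∧ Nontrivial (B i)

/-- `A` is the ordinal sum of a finite family with a first component: the first component (with
its least element `z` designated, which is the `0` of `A`) is a totally ordered MV-algebra, the
other components are non-trivial totally ordered Wajsberg hoops. The first component can be
trivial only if `A` is. -/
def BLFiniteIndex (A : Bundled.{u} bl.Structure) : Prop :=
  ∃ (I : Type) (_ : LinearOrder I) (_ : Finite I) (B : I → Bundled.{u} hoop.Structure)
    (ι : ∀ i, B i ↪[hoop] (reduct A)) (i₀ : I) (z : B i₀),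
    IsOrdinalSum B (reduct A) ι ∧
      (∀ i, i₀ ≤ i) ∧ IsMVAlgebra (withZero (B i₀) z) ∧ IsTotallyOrdered (B i₀) ∧ ι i₀ z = zero A ∧
      ∀ i, i ≠ i₀ → IsWajsbergHoop (B i) ∧ IsTotallyOrdered (B i) ∧ Nontrivial (B i)

/-- The totally ordered members of finite index of a class of basic hoops. -/
def hoopFC (V : Set (Bundled.{u} hoop.Structure)) : Set (Bundled.{u} hoop.Structure) :=
  {A | A ∈ V ∧ IsTotallyOrdered A ∧ HoopFiniteIndex A}

/-- The totally ordered members of finite index of a class of BL-algebras. -/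
def blFC (V : Set (Bundled.{u} bl.Structure)) : Set (Bundled.{u} bl.Structure) :=
  {A | A ∈ V ∧ IsTotallyOrdered (reduct A) ∧ BLFiniteIndex A}

end BLAmalgamation

namespace BLAmalgamation

/-! ### Basic hoops as a type class -/

/-! Congruences come from filters, and the quotient by a filter maximal among those avoiding a
join-closed set is a chain (`exists_maximal_filter`, `exists_chain_quotient`), so questions about a
variety reduce to chains. In a chain, `Same` partitions the elements other than `1` into Wajsberg
components. The dichotomy `himp_eq_or` makes this an ordinal decomposition: finite index means
finitely many components, and a union of components that contains `1` and the constants is a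
subalgebra. `HoopLang` treats both signatures at once; having only finitely many constants keeps
such unions finite.

From `V` to its chains of finite index: amalgamate an essential span in `V` and factor the amalgam
by a filter maximal among those avoiding the image of `N ∖ {1}`. Then `N` still embeds. The kernel
on `P` is trivial on `M`, because `M` embeds through `N`, so essentiality makes it trivial. The
finitely many components meeting the two images form the required amalgam.

Conversely, amalgamation is first weakened to a one-sided form: a commuting square in which `B`
embeds but `C` need not. For chains of finite index, factor `C` by a filter maximal among those
avoiding the image of `A ∖ {1}`; the map from `A` to the quotient is essential, so the hypothesis
applies. A reduced product over finite sets of components extends this to all chains. For an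
arbitrary span, two elements of `B` are separated by a prime filter, whose trace on `A` is also the
trace of a prime filter of `C`, and the chain case applies to the quotients. Doing this for all
pairs on both sides and taking the product of the squares gives an amalgam. -/

/-- Basic hoops, with Mathlib's notation for the operations. -/
class BasicHoop (α : Type u) extends Lattice α, CommMonoid α, HImp α where
  le_one' : ∀ x : α, x ≤ 1
  mul_le_iff : ∀ x y z : α, x * y ≤ z ↔ x ≤ y ⇨ z
  mul_himp : ∀ x y : α, x * (x ⇨ y) = x ⊓ y
  himp_sup_himp : ∀ x y : α, (x ⇨ y) ⊔ (y ⇨ x) = 1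

namespace BasicHoop

variable {α : Type u} [BasicHoop α] {x y z w : α}

instance : IsOrderedMonoid α where
  mul_le_mul_left a b h c :=
    (mul_le_iff a c _).2 (h.trans ((mul_le_iff b c _).1 le_rfl))

theorem le_one (x : α) : x ≤ 1 := le_one' x

theorem mul_himp_le (x y : α) : x * (x ⇨ y) ≤ y := (mul_himp x y).trans_le inf_le_right

theorem le_himp_iff : x ≤ y ⇨ z ↔ x * y ≤ z := (mul_le_iff x y z).symm

theorem mul_le_left (x y : α) : x * y ≤ x := mul_le_of_le_one_right' (le_one y)

theorem mul_le_right (x y : α) : x * y ≤ y := mul_le_of_le_one_left' (le_one x)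

theorem himp_eq_one : x ⇨ y = 1 ↔ x ≤ y := by
  rw [← one_mul x, ← le_himp_iff, one_mul]
  exact ⟨fun h => h.ge, fun h => le_antisymm (le_one _) h⟩

theorem himp_self (x : α) : x ⇨ x = 1 := himp_eq_one.2 le_rfl

theorem himp_one (x : α) : x ⇨ 1 = 1 := himp_eq_one.2 (le_one x)

theorem one_himp (x : α) : 1 ⇨ x = x := by
  apply le_antisymm
  · simpa using mul_himp_le 1 x
  · rw [le_himp_iff, mul_one]

theorem le_himp (x y : α) : y ≤ x ⇨ y := le_himp_iff.2 (mul_le_left y x)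

theorem mul_himp_eq (x y z : α) : (x * y) ⇨ z = x ⇨ (y ⇨ z) :=
  eq_of_forall_le_iff fun c => by
    rw [le_himp_iff, le_himp_iff, le_himp_iff, mul_assoc]

theorem himp_left_comm (x y z : α) : x ⇨ (y ⇨ z) = y ⇨ (x ⇨ z) := by
  rw [← mul_himp_eq, ← mul_himp_eq, mul_comm]

theorem himp_anti (h : x ≤ y) (z : α) : y ⇨ z ≤ x ⇨ z :=
  le_himp_iff.2 ((mul_le_mul_right h _).trans ((mul_comm _ _).trans_le (mul_himp_le y z)))

theorem himp_mono (h : x ≤ y) (z : α) : z ⇨ x ≤ z ⇨ y :=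
  le_himp_iff.2 (((mul_comm _ _).trans_le (mul_himp_le z x)).trans h)

theorem le_himp_himp (x y : α) : x ≤ (x ⇨ y) ⇨ y := le_himp_iff.2 (mul_himp_le x y)

theorem himp_himp_himp (x y : α) : ((x ⇨ y) ⇨ y) ⇨ y = x ⇨ y :=
  le_antisymm (himp_anti (le_himp_himp x y) y) (le_himp_himp _ _)

theorem mul_himp_of_le (h : y ≤ x) : x * (x ⇨ y) = y := by rw [mul_himp, inf_eq_right.2 h]

theorem mul_sup_le (h₁ : x * y ≤ w) (h₂ : x * z ≤ w) : x * (y ⊔ z) ≤ w := by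
  rw [mul_comm, ← le_himp_iff, sup_le_iff, le_himp_iff, le_himp_iff, mul_comm y, mul_comm z]
  exact ⟨h₁, h₂⟩

/-- This is what makes the residual of a filter closed under products. -/
theorem sup_mul_sup_le (x y z : α) : (x ⊔ z) * (y ⊔ z) ≤ x * y ⊔ z := by
  refine mul_sup_le ?_ ((mul_le_right _ _).trans le_sup_right)
  rw [mul_comm]
  refine mul_sup_le ?_ ((mul_le_right _ _).trans le_sup_right)
  rw [mul_comm]
  exact le_sup_left

/-! ### Filters -/

/-- A filter of a basic hoop. -/
structure IsFilter (F : Set α) : Prop where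
  one_mem : 1 ∈ F
  mul_mem : ∀ {x y}, x ∈ F → y ∈ F → x * y ∈ F
  mem_of_le : ∀ {x y}, x ∈ F → x ≤ y → y ∈ F

theorem isFilter_one : IsFilter ({1} : Set α) where
  one_mem := rfl
  mul_mem := by rintro x y rfl rfl; exact mul_one _
  mem_of_le := by rintro x y rfl h; exact le_antisymm (le_one _) h

/-- The residual of a filter by an element. -/
theorem IsFilter.residual {F : Set α} (hF : IsFilter F) (z : α) : IsFilter {x | x ⊔ z ∈ F} where
  one_mem := hF.mem_of_le hF.one_mem le_sup_left
  mul_mem hx hy := hF.mem_of_le (hF.mul_mem hx hy) (sup_mul_sup_le _ _ _)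
  mem_of_le hx h := hF.mem_of_le hx (sup_le_sup_right h z)

theorem IsFilter.himp_trans {F : Set α} (hF : IsFilter F) (h₁ : x ⇨ y ∈ F) (h₂ : y ⇨ z ∈ F) :
    x ⇨ z ∈ F := by
  refine hF.mem_of_le (hF.mul_mem h₁ h₂) (le_himp_iff.2 ?_)
  calc (x ⇨ y) * (y ⇨ z) * x = x * (x ⇨ y) * (y ⇨ z) := by ac_rfl
    _ ≤ y * (y ⇨ z) := mul_le_mul_left (mul_himp_le x y) _
    _ ≤ z := mul_himp_le y z

/-- With the three analogous bounds below, this makes the relation defined by a filter compatible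
with the operations. -/
theorem himp_mul_himp_mul_le (x x' y y' : α) : (x ⇨ x') * (y ⇨ y') ≤ (x * y) ⇨ (x' * y') := by
  rw [le_himp_iff]
  calc (x ⇨ x') * (y ⇨ y') * (x * y) = (x * (x ⇨ x')) * (y * (y ⇨ y')) := by ac_rfl
    _ ≤ x' * y' := mul_le_mul' (mul_himp_le _ _) (mul_himp_le _ _)

theorem himp_mul_himp_himp_le (x x' y y' : α) :
    (x' ⇨ x) * (y ⇨ y') ≤ (x ⇨ y) ⇨ (x' ⇨ y') := by
  rw [le_himp_iff, le_himp_iff]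
  calc (x' ⇨ x) * (y ⇨ y') * (x ⇨ y) * x' = (x' * (x' ⇨ x)) * (x ⇨ y) * (y ⇨ y') := by ac_rfl
    _ ≤ x * (x ⇨ y) * (y ⇨ y') :=
      mul_le_mul_left (mul_le_mul_left (mul_himp_le _ _) _) _
    _ ≤ y * (y ⇨ y') := mul_le_mul_left (mul_himp_le _ _) _
    _ ≤ y' := mul_himp_le _ _

theorem himp_mul_himp_inf_le (x x' y y' : α) : (x ⇨ x') * (y ⇨ y') ≤ (x ⊓ y) ⇨ (x' ⊓ y') := by
  exact le_himp_iff.2 (le_inf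
    (le_himp_iff.1 ((mul_le_left _ _).trans (himp_anti inf_le_left _)))
    (le_himp_iff.1 ((mul_le_right _ _).trans (himp_anti inf_le_right _))))

theorem himp_mul_himp_sup_le (x x' y y' : α) : (x ⇨ x') * (y ⇨ y') ≤ (x ⊔ y) ⇨ (x' ⊔ y') := by
  rw [le_himp_iff]
  refine mul_sup_le ?_ ?_ <;> rw [← le_himp_iff]
  · exact (mul_le_left _ _).trans (himp_mono le_sup_left _)
  · exact (mul_le_right _ _).trans (himp_mono le_sup_right _)

/-- A filter maximal among those that avoid a set closed under joins is prime. -/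
theorem exists_maximal_filter {S G : Set α} (hS : ∀ s ∈ S, ∀ t ∈ S, s ⊔ t ∈ S)
    (hG : IsFilter G) (hGS : ∀ s ∈ S, s ∉ G) :
    ∃ F : Set α, G ⊆ F ∧ IsFilter F ∧ (∀ s ∈ S, s ∉ F) ∧
      (∀ H, IsFilter H → F ⊆ H → (∀ s ∈ S, s ∉ H) → H ⊆ F) ∧
      ∀ x y, x ⇨ y ∈ F ∨ y ⇨ x ∈ F := by
  obtain ⟨F, hGF, hF⟩ := zorn_subset_nonempty {F : Set α | IsFilter F ∧ ∀ s ∈ S, s ∉ F} (by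
    intro c hc hchain hne
    refine ⟨⋃₀ c, ⟨⟨?_, ?_, ?_⟩, ?_⟩, fun s hs => Set.subset_sUnion_of_mem hs⟩
    · obtain ⟨s, hs⟩ := hne
      exact ⟨s, hs, (hc hs).1.one_mem⟩
    · rintro x y ⟨s, hs, hx⟩ ⟨t, ht, hy⟩
      rcases hchain.total hs ht with h | h
      · exact ⟨t, ht, (hc ht).1.mul_mem (h hx) hy⟩
      · exact ⟨s, hs, (hc hs).1.mul_mem hx (h hy)⟩
    · rintro x y ⟨s, hs, hx⟩ h
      exact ⟨s, hs, (hc hs).1.mem_of_le hx h⟩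
    · rintro a ha ⟨s, hs, has⟩
      exact (hc hs).2 a ha has) G ⟨hG, hGS⟩
  have hmax : ∀ H, IsFilter H → F ⊆ H → (∀ s ∈ S, s ∉ H) → H ⊆ F :=
    fun H hH hFH hHS => hF.2 ⟨hH, hHS⟩ hFH
  refine ⟨F, hGF, hF.1.1, hF.1.2, hmax, fun x y => ?_⟩
  have hf := hF.1.1
  -- The residual of `F` by `q` is a filter containing `F` and `p`, so by maximality it meets `S`.
  -- Applying this twice replaces both members of `(x ⇨ y) ⊔ (y ⇨ x) = 1` by elements of `S`.
  have key : ∀ p q, p ⊔ q ∈ F → p ∉ F → ∃ s ∈ S, s ⊔ q ∈ F := by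
    intro p q hpq hp
    by_contra! hcon
    exact hp (hmax _ (hf.residual q) (fun a ha => hf.mem_of_le ha le_sup_left) hcon hpq)
  by_contra! hcon
  obtain ⟨s, hs, h⟩ := key (x ⇨ y) (y ⇨ x) (by rw [himp_sup_himp]; exact hf.one_mem) hcon.1
  rw [sup_comm] at h
  obtain ⟨t, ht, h⟩ := key _ _ h hcon.2
  exact hF.1.2 _ (hS t ht s hs) h

/-! ### The components of a chain -/

/-- Two elements of a chain belong to the same Wajsberg component. -/
def Same (x y : α) : Prop := x ≠ 1 ∧ y ≠ 1 ∧ (x ⇨ y) ⇨ y = (y ⇨ x) ⇨ x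

theorem Same.symm (h : Same x y) : Same y x := ⟨h.2.1, h.1, h.2.2.symm⟩

theorem Same.refl (h : x ≠ 1) : Same x x := ⟨h, h, rfl⟩

/-- `x` lies in a component strictly below the component of `y`, or `y = 1`. -/
def Below (x y : α) : Prop := x ≤ y ∧ y ⇨ x = x

theorem Below.mul_eq (h : Below x y) : y * x = x := by
  conv_lhs => rw [← h.2]
  exact mul_himp_of_le h.1

theorem same_iff_of_le (hx : x ≠ 1) (hy : y ≠ 1) (h : x ≤ y) : Same x y ↔ (y ⇨ x) ⇨ x = y := by
  simp only [Same, himp_eq_one.2 h, one_himp, hx, hy, ne_eq, not_false_eq_true, true_and]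
  exact eq_comm

theorem Below.trans_le (h : Below x y) (hyz : y ≤ z) : Below x z :=
  ⟨h.1.trans hyz, le_antisymm ((himp_anti hyz x).trans h.2.le) (le_himp z x)⟩

section Chain

variable (htot : ∀ x y : α, x ≤ y ∨ y ≤ x)
include htot

/-- The source of the decomposition into components. Put `w = y ⇨ x`, `z = w ⇨ x ≥ y` and `u = z ⇨
y`, so that `z * u = y` and `z ⇨ x = w`. If both alternatives fail, then `u ⇨ w = w` and hence `u *
w = w`; comparing `z` with `u` gives a contradiction either way. -/
theorem himp_eq_or (hxy : x ≤ y) : (y ⇨ x) ⇨ x = y ∨ y ⇨ x = x := by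
  by_contra! hcon
  obtain ⟨hz, hw⟩ := hcon
  set w := y ⇨ x with hwdef
  set z := w ⇨ x with hzdef
  set u := z ⇨ y with hudef
  have hyz : y ≤ z := le_himp_himp y x
  have hzy : ¬ z ≤ y := fun h => hz (le_antisymm h hyz)
  have hzu : z * u = y := mul_himp_of_le hyz
  have hzx : z ⇨ x = w := himp_himp_himp y x
  have hxw : x ≤ w := le_himp y x
  have huw : u ⇨ w = w := by rw [← hzx, ← mul_himp_eq, mul_comm, hzu, hzx]
  have hw1 : w ≠ 1 := by
    intro h
    have : y ≤ x := himp_eq_one.1 h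
    exact hz (by rw [hzdef, h, one_himp]; exact le_antisymm hxy this)
  have hwu : w ≤ u := (htot w u).resolve_right fun h => hw1 (by rw [← huw]; exact himp_eq_one.2 h)
  have huw' : u * w = w := Below.mul_eq ⟨hwu, huw⟩
  rcases htot z u with h | h
  · have hs : u * (u ⇨ z) = z := mul_himp_of_le h
    -- Since `w = u * w`, multiplying `w` by `u ⇨ z` is the same as multiplying it by `u * (u ⇨ z) =
    -- z`.
    have hsz : u ⇨ z ≤ z := by
      rw [hzdef, le_himp_iff, ← hzdef]
      calc (u ⇨ z) * w = (u ⇨ z) * (u * w) := by rw [huw']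
        _ = u * (u ⇨ z) * w := by ac_rfl
        _ = w * (w ⇨ x) := by rw [hs, hzdef, mul_comm]
        _ ≤ x := mul_himp_le w x
    apply hzy
    calc z = u * (u ⇨ z) := hs.symm
      _ ≤ u * z := mul_le_mul_right hsz u
      _ = y := by rw [mul_comm, hzu]
  -- As `u ⇨ w = w`, residuating `w` by `y = z * u` amounts to residuating it by `z`, and `u ≤ z`.
  · have h1 : y ⇨ w ≤ w := by
      calc y ⇨ w = z ⇨ w := by
            conv_lhs => rw [← hzu, mul_himp_eq, huw]
        _ ≤ u ⇨ w := himp_anti h w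
        _ = w := huw
    rcases htot w y with h' | h'
    · refine hw (le_antisymm ?_ hxw)
      calc w = y * (y ⇨ w) := (mul_himp_of_le h').symm
        _ ≤ y * w := mul_le_mul_right h1 y
        _ ≤ x := mul_himp_le y x
    · exact hw1 (le_antisymm (le_one w) ((himp_eq_one.2 h').symm.trans_le h1))

theorem same_or_below (hx : x ≠ 1) (hy : y ≠ 1) (h : x ≤ y) : Same x y ∨ Below x y := by
  rw [same_iff_of_le hx hy h]
  exact (himp_eq_or htot h).imp_right fun h' => ⟨h, h'⟩

omit htot in
theorem Same.not_below (h : Same x y) : ¬ (Below x y) := by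
  intro hb
  have h' := (same_iff_of_le h.1 h.2.1 hb.1).1 h
  rw [hb.2, himp_self] at h'
  exact h.2.1 h'.symm

/-- Multiplication by `z` fixes every element below `y`, since such an element is a multiple of `y`
and `z * y = y`. If `z ⇨ x ≤ y`, this yields `z ⇨ x ≤ x`; otherwise `y = z * y ≤ x`. -/
theorem Below.of_le (h : Below y z) (hxy : x ≤ y) : Below x z := by
  refine ⟨hxy.trans h.1, le_antisymm ?_ (le_himp z x)⟩
  have hyz := h.mul_eq
  have hx := mul_himp_le z x
  rcases htot (z ⇨ x) y with h' | h'
  · calc z ⇨ x = z * (z ⇨ x) := by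
          conv_rhs => rw [← mul_himp_of_le h', ← mul_assoc, hyz]
          exact (mul_himp_of_le h').symm
      _ ≤ x := hx
  · have : y ≤ x := by
      calc y = z * y := hyz.symm
        _ ≤ z * (z ⇨ x) := mul_le_mul_right h' z
        _ ≤ x := hx
    rw [le_antisymm hxy this, h.2]

omit htot in
-- Write `y` as `(y ⇨ x) ⇨ x`: residuation by `z` commutes past `y ⇨ x` and is absorbed at `x`.
theorem Below.of_same_left (h : Below x z) (hxy : Same x y) (hle : x ≤ y) : y ≤ z → Below y z := by
  intro hyz
  refine ⟨hyz, ?_⟩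
  rw [same_iff_of_le hxy.1 hxy.2.1 hle] at hxy
  conv_lhs => rw [← hxy, himp_left_comm, h.2]
  exact hxy

/-- If `x ≤ z` lay in different components, then `Below x z`. Wherever `y` lies, this passes to
`Below x y` or `Below y z`, or to `Below y z` from the left when `y ≤ x`, against the hypotheses. -/
theorem Same.trans (h₁ : Same x y) (h₂ : Same y z) : Same x z := by
  have main : ∀ {x y z : α}, Same x y → Same y z → x ≤ z → Same x z := by
    intro x y z h₁ h₂ hxz
    refine (same_or_below htot h₁.1 h₂.2.1 hxz).resolve_right fun hb => ?_
    rcases htot x y with hxy | hyx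
    · rcases htot y z with hyz | hzy
      · exact h₂.not_below (hb.of_same_left h₁ hxy hyz)
      · exact h₁.not_below (hb.trans_le hzy)
    · exact h₂.not_below (hb.of_le htot hyx)
  rcases htot x z with h | h
  · exact main h₁ h₂ h
  · exact (main h₂.symm h₁.symm h).symm

/-- Components are convex: `Below x y` would propagate upwards to `Below x z`. -/
theorem Same.of_le_of_le (h : Same x z) (hxy : x ≤ y) (hyz : y ≤ z) : Same x y := by
  have hy : y ≠ 1 := fun h1 => h.2.1 (le_antisymm (le_one z) (h1.symm.trans_le hyz))
  exact (same_or_below htot h.1 hy hxy).resolve_right fun hb => h.not_below (hb.trans_le hyz)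

theorem below_of_not_same (hx : x ≠ 1) (hle : x ≤ y) (h : ¬ Same x y) : Below x y := by
  by_cases hy : y = 1
  · exact ⟨hle, by rw [hy, one_himp]⟩
  · exact (same_or_below htot hx hy hle).resolve_left h

/-- Residuals of elements of a component are either `1` or in this component. -/
theorem himp_same (hy : Same x y) : x ⇨ y = 1 ∨ Same y (x ⇨ y) := by
  rcases htot x y with h | h
  · exact Or.inl (himp_eq_one.2 h)
  · by_cases h1 : x ⇨ y = 1
    · exact Or.inl h1
    refine Or.inr ((same_or_below htot hy.2.1 h1 (le_himp x y)).resolve_right fun hb => ?_)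
    have h2 := (same_iff_of_le hy.2.1 hy.1 h).1 hy.symm
    have h3 : y = x := hb.2.symm.trans h2
    exact h1 (by rw [h3, himp_self])

theorem mul_same (hxy : Same x y) : Same x (x * y) := by
  have main : ∀ {x y : α}, Same x y → x ≤ y → Same x (x * y) := by
    intro x y hxy h
    have h1 : x * y ≠ 1 := fun h1 => hxy.1 (le_antisymm (le_one x) (h1.symm.trans_le (mul_le_left x y)))
    -- If `x * y` dropped below the component of `x`, then `x ≤ y ≤ x ⇨ x * y = x * y`, so `x * y =
    -- x` after all.
    refine ((same_or_below htot h1 hxy.1 (mul_le_left x y)).imp_right fun hb => ?_).elim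
      Same.symm id
    have h2 : x ≤ x * y :=
      calc x ≤ y := h
        _ ≤ x ⇨ (x * y) := le_himp_iff.2 (mul_comm y x).le
        _ = x * y := hb.2
    rw [← le_antisymm h2 (mul_le_left x y)]
    exact Same.refl hxy.1
  rcases htot x y with h | h
  · exact main hxy h
  · rw [mul_comm]
    exact hxy.trans htot (main hxy.symm h)

/-- The union of the components of the elements of `F`, together with `1`. -/
def inComponents (F : Set α) : Set α := {x | x = 1 ∨ ∃ f ∈ F, Same x f}

variable {F : Set α}

theorem inf_mem_inComponents (hx : x ∈ inComponents F) (hy : y ∈ inComponents F) :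
    x ⊓ y ∈ inComponents F := by
  rcases htot x y with h | h
  · rwa [inf_eq_left.2 h]
  · rwa [inf_eq_right.2 h]

theorem sup_mem_inComponents (hx : x ∈ inComponents F) (hy : y ∈ inComponents F) :
    x ⊔ y ∈ inComponents F := by
  rcases htot x y with h | h
  · rwa [sup_eq_right.2 h]
  · rwa [sup_eq_left.2 h]

theorem mem_inComponents_of_same (hx : x ∈ inComponents F) (h : Same x y) :
    y ∈ inComponents F := by
  obtain ⟨f, hf, hxf⟩ := hx.resolve_left h.1
  exact Or.inr ⟨f, hf, h.symm.trans htot hxf⟩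

theorem mul_mem_inComponents (hx : x ∈ inComponents F) (hy : y ∈ inComponents F) :
    x * y ∈ inComponents F := by
  have main : ∀ {x y : α}, x ∈ inComponents F → x ≤ y → x * y ∈ inComponents F := by
    intro x y hx h
    by_cases hx1 : x = 1
    · have : y = 1 := le_antisymm (le_one y) (hx1 ▸ h)
      exact Or.inl (by rw [hx1, this, one_mul])
    by_cases hs : Same x y
    · exact mem_inComponents_of_same htot hx (mul_same htot hs)
    · rwa [mul_comm, (below_of_not_same htot hx1 h hs).mul_eq]
  rcases htot x y with h | h
  · exact main hx h
  · rw [mul_comm]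
    exact main hy h

theorem himp_mem_inComponents (hy : y ∈ inComponents F) : x ⇨ y ∈ inComponents F := by
  rcases htot x y with h | h
  · exact Or.inl (himp_eq_one.2 h)
  by_cases hy1 : y = 1
  · exact Or.inl (by rw [hy1, himp_one])
  by_cases hs : Same y x
  · rcases himp_same htot hs.symm with h' | h'
    · exact Or.inl h'
    · exact mem_inComponents_of_same htot hy h'
  · rwa [(below_of_not_same htot hy1 h hs).2]

end Chain

end BasicHoop

end BLAmalgamation

namespace BLAmalgamation

open CategoryTheory FirstOrder.Language.Structure
open scoped FirstOrder

/-! ### Constructions with algebras and closure properties of varieties -/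

section Constructions

variable {L : FirstOrder.Language.{0, 0}}

/-- Identities can be checked after applying a jointly injective family of homomorphisms; this
covers subalgebras and products together. -/
theorem IsVariety.mem_of_jointly_injective {V : Set (Bundled.{u} L.Structure)} (hV : IsVariety V)
    {ι : Type*} {N : Bundled.{u} L.Structure} {M : ι → Bundled.{u} L.Structure}
    (f : ∀ i, N →[L] M i) (hM : ∀ i, M i ∈ V) (hf : ∀ x y, (∀ i, f i x = f i y) → x = y) :
    N ∈ V := by
  obtain ⟨E, hE⟩ := hV
  refine (hE N).2 fun e he v => hf _ _ fun i => ?_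
  rw [← FirstOrder.Language.HomClass.realize_term, ← FirstOrder.Language.HomClass.realize_term]
  exact (hE (M i)).1 (hM i) e he _

theorem IsVariety.mem_of_injective {V : Set (Bundled.{u} L.Structure)} (hV : IsVariety V)
    {N M : Bundled.{u} L.Structure} (f : N →[L] M) (hM : M ∈ V) (hf : Function.Injective f) :
    N ∈ V :=
  hV.mem_of_jointly_injective (ι := Unit) (fun _ => f) (fun _ => hM) fun _ _ h => hf (h ())

theorem IsVariety.mem_of_surjective {V : Set (Bundled.{u} L.Structure)} (hV : IsVariety V)
    {M N : Bundled.{u} L.Structure} (f : M →[L] N) (hM : M ∈ V) (hf : Function.Surjective f) :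
    N ∈ V := by
  obtain ⟨E, hE⟩ := hV
  refine (hE N).2 fun e he v => ?_
  obtain ⟨w, rfl⟩ : ∃ w : ℕ → M, f ∘ w = v :=
    ⟨fun n => (hf (v n)).choose, funext fun n => (hf (v n)).choose_spec⟩
  rw [FirstOrder.Language.HomClass.realize_term, FirstOrder.Language.HomClass.realize_term,
    (hE M).1 hM e he w]

/-- Homomorphisms of algebras only have to preserve the operations. -/
def homOfMapFun [L.IsAlgebraic] {M N : Type u} [L.Structure M] [L.Structure N] (f : M → N)
    (hf : ∀ {n} (g : L.Functions n) (x : Fin n → M), f (funMap g x) = funMap g (f ∘ x)) :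
    M →[L] N where
  toFun := f
  map_fun' := hf
  map_rel' r := isEmptyElim r

/-- A homomorphism that respects the kernel of a surjective one factors through it. -/
theorem exists_hom_of_surjective [L.IsAlgebraic] {M N P : Type u} [L.Structure M] [L.Structure N]
    [L.Structure P] (q : M →[L] N) (hq : Function.Surjective q) (h : M →[L] P)
    (hk : ∀ x y, q x = q y → h x = h y) : ∃ k : N →[L] P, ∀ x, k (q x) = h x := by
  have hs := Function.surjInv_eq hq
  have key : ∀ x, h (Function.surjInv hq (q x)) = h x := fun x => hk _ _ (hs _)
  refine ⟨homOfMapFun (fun y => h (Function.surjInv hq y)) fun {n} g x => ?_, key⟩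
  have hx : x = q ∘ (fun i => Function.surjInv hq (x i)) := funext fun i => (hs _).symm
  conv_lhs => rw [hx, ← q.map_fun, key, h.map_fun]
  rfl

/-! ### Quotients by congruences -/

section Quotient

variable [L.IsAlgebraic]

/-- The quotient of an algebra by a congruence. -/
noncomputable def Congruence.quotient {M : Type u} [L.Structure M] (θ : Congruence L M) :
    Bundled.{u} L.Structure :=
  ⟨Quotient θ.toSetoid,
    { funMap := fun f x => Quotient.mk θ.toSetoid (funMap f fun i => (x i).out)
      RelMap := fun r _ => isEmptyElim r }⟩

/-- The quotient map. -/
noncomputable def Congruence.proj {M : Type u} [L.Structure M] (θ : Congruence L M) :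
    M →[L] θ.quotient :=
  homOfMapFun (Quotient.mk θ.toSetoid) fun g x => by
    refine Quotient.sound (θ.compat g _ _ fun i => ?_)
    exact θ.toSetoid.symm (Quotient.mk_out (s := θ.toSetoid) (x i))

theorem Congruence.proj_surjective {M : Type u} [L.Structure M] (θ : Congruence L M) :
    Function.Surjective θ.proj := Quotient.mk_surjective

theorem Congruence.proj_eq_proj {M : Type u} [L.Structure M] (θ : Congruence L M) {x y : M} :
    θ.proj x = θ.proj y ↔ θ.toSetoid x y := Quotient.eq (r := θ.toSetoid)

end Quotient

/-- The kernel of a homomorphism. -/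
def kernel {M N : Type u} [L.Structure M] [L.Structure N] (f : M →[L] N) : Congruence L M where
  toSetoid := Setoid.ker f
  compat g x y h := by
    rw [Setoid.ker_def, f.map_fun, f.map_fun]
    congr 1
    exact funext h

/-! ### Direct and reduced products -/

/-- The direct product. -/
def product [L.IsAlgebraic] {ι : Type u} (D : ι → Bundled.{u} L.Structure) :
    Bundled.{u} L.Structure :=
  ⟨∀ i, D i,
    { funMap := fun f x i => funMap f fun k => x k i
      RelMap := fun r _ => isEmptyElim r }⟩

/-- The projections of a direct product. -/
def productEval [L.IsAlgebraic] {ι : Type u} (D : ι → Bundled.{u} L.Structure) (i : ι) :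
    product D →[L] D i :=
  homOfMapFun (fun x => x i) fun _ _ => rfl

theorem IsVariety.product_mem [L.IsAlgebraic] {V : Set (Bundled.{u} L.Structure)}
    (hV : IsVariety V) {ι : Type u} {D : ι → Bundled.{u} L.Structure} (hD : ∀ i, D i ∈ V) :
    product D ∈ V :=
  hV.mem_of_jointly_injective (productEval D) hD fun _ _ h => funext h

/-- The homomorphism to a product given by its components. -/
def productLift [L.IsAlgebraic] {ι : Type u} {D : ι → Bundled.{u} L.Structure} {M : Type u}
    [L.Structure M] (f : ∀ i, M →[L] D i) : M →[L] product D :=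
  homOfMapFun (fun x i => f i x) fun g x => funext fun i => (f i).map_fun g x

/-- Equality modulo a filter, as a congruence of the direct product. -/
def reducedCongruence [L.IsAlgebraic] {ι : Type u} (D : ι → Bundled.{u} L.Structure)
    (l : Filter ι) : Congruence L (product D) where
  r x y := ∀ᶠ i in l, x i = y i
  iseqv := ⟨fun _ => Filter.Eventually.of_forall fun _ => rfl,
    fun h => h.mono fun _ => Eq.symm,
    fun h₁ h₂ => (h₁.and h₂).mono fun _ h => h.1.trans h.2⟩
  compat f x y h := (Filter.eventually_all.2 h).mono fun i hi => by
    change funMap f (fun k => x k i) = funMap f (fun k => y k i)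
    rw [funext hi]

/-- The reduced product modulo a filter. -/
noncomputable abbrev reducedProduct [L.IsAlgebraic] {ι : Type u} (D : ι → Bundled.{u} L.Structure)
    (l : Filter ι) : Bundled.{u} L.Structure := (reducedCongruence D l).quotient

theorem IsVariety.reducedProduct_mem [L.IsAlgebraic] {V : Set (Bundled.{u} L.Structure)}
    (hV : IsVariety V) {ι : Type u} {D : ι → Bundled.{u} L.Structure} (l : Filter ι)
    (hD : ∀ i, D i ∈ V) : reducedProduct D l ∈ V :=
  hV.mem_of_surjective _ (hV.product_mem hD) (reducedCongruence D l).proj_surjective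

/-- Homomorphisms defined on substructures that eventually contain each element induce a
homomorphism to the reduced product. -/
theorem exists_hom_reducedProduct [L.IsAlgebraic] {ι : Type u} {D : ι → Bundled.{u} L.Structure}
    [∀ i, Nonempty (D i)] (l : Filter ι) {B : Type u} [L.Structure B] (S : ι → L.Substructure B)
    (h : ∀ i, S i →[L] D i) (hS : ∀ b, ∀ᶠ i in l, b ∈ S i) :
    ∃ H : B →[L] reducedProduct D l, ∀ b, ∃ x : product D,
      H b = (reducedCongruence D l).proj x ∧ ∀ i (hb : b ∈ S i), x i = h i ⟨b, hb⟩ := by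
  classical
  -- The value outside `S i` is arbitrary: each `b` lies in `S i` eventually, so the choice
  -- disappears modulo the filter.
  let s : B → product D := fun b i => if hb : b ∈ S i then h i ⟨b, hb⟩ else Classical.arbitrary _
  have hs : ∀ b i (hb : b ∈ S i), s b i = h i ⟨b, hb⟩ := fun b i hb => dif_pos hb
  refine ⟨homOfMapFun (fun b => (reducedCongruence D l).proj (s b)) fun {n} g x => ?_,
    fun b => ⟨s b, rfl, hs b⟩⟩
  change _ = funMap g ((reducedCongruence D l).proj ∘ fun k => s (x k))
  rw [← FirstOrder.Language.Hom.map_fun, Congruence.proj_eq_proj]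
  refine (Filter.eventually_all.2 fun k => hS (x k)).mono fun i hi => ?_
  change s (funMap g x) i = funMap g (fun k => s (x k) i)
  rw [hs _ _ ((S i).fun_mem g x hi)]
  have : (fun k => s (x k) i) = h i ∘ fun k => ⟨x k, hi k⟩ := funext fun k => hs _ _ (hi k)
  rw [this, ← (h i).map_fun]
  rfl

end Constructions

/-! ### Languages of hoops with constants -/

/-- A language whose operations are those of hoops and finitely many constants. -/
class HoopLang (L : FirstOrder.Language.{0, 0}) where
  incl : hoop →ᴸ L
  isAlgebraic : L.IsAlgebraic
  finite_constants : Finite (L.Functions 0)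
  eq_zero_or_hoop : ∀ {n} (f : L.Functions n), n = 0 ∨ ∃ g, incl.onFunction g = f

variable {L : FirstOrder.Language.{0, 0}} [HoopLang L]

instance : L.IsAlgebraic := HoopLang.isAlgebraic

instance : Finite (L.Functions 0) := HoopLang.finite_constants

/-- The hoop reduct of an algebra. -/
def red (A : Bundled.{u} L.Structure) : Bundled.{u} hoop.Structure :=
  ⟨A, (HoopLang.incl (L := L)).reduct A⟩

variable (L) in
/-- The hoop operation `g` in the language `L`. -/
abbrev op {n : ℕ} (g : HoopFunc n) : L.Functions n := (HoopLang.incl (L := L)).onFunction g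

variable (L) in
/-- Compatibility of a basic hoop with an `L`-structure on the same type. -/
class CompatibleHoop (M : Type u) [L.Structure M] [BasicHoop M] : Prop where
  funMap_one : ∀ v : Fin 0 → M, funMap (op L .one) v = 1
  funMap_inf : ∀ v : Fin 2 → M, funMap (op L .inf) v = v 0 ⊓ v 1
  funMap_sup : ∀ v : Fin 2 → M, funMap (op L .sup) v = v 0 ⊔ v 1
  funMap_mul : ∀ v : Fin 2 → M, funMap (op L .mul) v = v 0 * v 1
  funMap_imp : ∀ v : Fin 2 → M, funMap (op L .imp) v = v 0 ⇨ v 1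

open CompatibleHoop

theorem IsICRL.inf_self {A : Bundled.{u} hoop.Structure} (h : IsICRL A) (x : A) : inf x x = x := by
  have := h.inf_sup_self x (inf x x)
  rwa [h.sup_inf_self] at this

/-- The order-theoretic presentation of a basic hoop. -/
@[reducible] def IsBasicHoop.toBasicHoop {A : Bundled.{u} hoop.Structure} (h : IsBasicHoop A) :
    BasicHoop A where
  le x y := le x y
  le_refl x := h.inf_self x
  le_trans x y z (hx : inf x y = x) (hy : inf y z = y) := by
    change inf x z = x
    rw [← hx, h.inf_assoc, hy]
  le_antisymm x y (hx : inf x y = x) (hy : inf y x = y) := by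
    rw [← hx, h.inf_comm, hy]
  inf := inf
  sup := sup
  inf_le_left x y := by
    change inf (inf x y) x = inf x y
    rw [h.inf_comm, ← h.inf_assoc, h.inf_self]
  inf_le_right x y := by
    change inf (inf x y) y = inf x y
    rw [h.inf_assoc, h.inf_self]
  le_inf x y z (hx : inf x y = x) (hy : inf x z = x) := by
    change inf x (inf y z) = x
    rw [← h.inf_assoc, hx, hy]
  le_sup_left x y := h.inf_sup_self x y
  le_sup_right x y := by
    change inf y (sup x y) = y
    rw [h.sup_comm, h.inf_sup_self]
  sup_le x y z (hx : inf x z = x) (hy : inf y z = y) := by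
    have h' : ∀ {x}, inf x z = x → sup z x = z := fun {x} hx => by
      rw [← hx, h.inf_comm, h.sup_inf_self]
    change inf (sup x y) z = sup x y
    have : sup (sup x y) z = z := by
      rw [h.sup_comm, ← h.sup_assoc, h' hx, h' hy]
    conv_lhs => rw [← this]
    exact h.inf_sup_self _ _
  mul := mul
  one := one
  mul_assoc := h.mul_assoc
  mul_comm := h.mul_comm
  one_mul := h.one_mul
  mul_one x := (h.mul_comm _ _).trans (h.one_mul x)
  himp := imp
  le_one' := h.le_one
  mul_le_iff := h.residuation
  mul_himp := h.divisible
  himp_sup_himp := h.prelinear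

theorem IsBasicHoop.compatibleHoop {A : Bundled.{u} L.Structure} (h : IsBasicHoop (red A)) :
    @CompatibleHoop L _ A _ h.toBasicHoop := by
  let _ : BasicHoop A := h.toBasicHoop (A := red A)
  have h2 : ∀ v : Fin 2 → A, v = ![v 0, v 1] := fun v => by
    ext i; fin_cases i <;> rfl
  constructor
  · intro v; rw [Subsingleton.elim v (![])]; rfl
  all_goals intro v; conv_lhs => rw [h2 v]
  all_goals rfl

/-! ### Homomorphisms, order and components -/

section Maps

variable {M N : Type u} [L.Structure M] [L.Structure N] [BasicHoop M] [BasicHoop N]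
  [CompatibleHoop L M] [CompatibleHoop L N] (f : M →[L] N)

omit [BasicHoop M] [CompatibleHoop L M] [BasicHoop N] [CompatibleHoop L N] in
theorem hom_binary (g : HoopFunc 2) (x y : M) :
    f (funMap (op L g) ![x, y]) = funMap (op L g) ![f x, f y] := by
  rw [f.map_fun]; congr 1; ext i; fin_cases i <;> rfl

theorem hom_one : f 1 = 1 := by
  rw [← funMap_one (L := L) (M := M) ![], f.map_fun, funMap_one]

theorem hom_inf (x y : M) : f (x ⊓ y) = f x ⊓ f y := by
  simpa [funMap_inf] using hom_binary f .inf x y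

theorem hom_sup (x y : M) : f (x ⊔ y) = f x ⊔ f y := by
  simpa [funMap_sup] using hom_binary f .sup x y

theorem hom_mul (x y : M) : f (x * y) = f x * f y := by
  simpa [funMap_mul] using hom_binary f .mul x y

theorem hom_himp (x y : M) : f (x ⇨ y) = f x ⇨ f y := by
  simpa [funMap_imp] using hom_binary f .imp x y

theorem hom_mono {x y : M} (h : x ≤ y) : f x ≤ f y := by
  rw [← inf_eq_left, ← hom_inf, inf_eq_left.2 h]

variable {f} (hf : Function.Injective f)
include hf

theorem hom_eq_one {x : M} : f x = 1 ↔ x = 1 := by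
  rw [← hom_one f, hf.eq_iff]

theorem hom_le_iff {x y : M} : f x ≤ f y ↔ x ≤ y := by
  rw [← inf_eq_left, ← hom_inf, hf.eq_iff, inf_eq_left]

theorem hom_same_iff {x y : M} : BasicHoop.Same (f x) (f y) ↔ BasicHoop.Same x y := by
  simp only [BasicHoop.Same, ne_eq, hom_eq_one hf, ← hom_himp, hf.eq_iff]

end Maps

/-! ### Filters, congruences, components -/

section Alg

variable {M : Type u} [L.Structure M] [BasicHoop M] [CompatibleHoop L M]

variable (L) in
/-- The congruence of a filter. -/
def filterCongruence {F : Set M} (hF : BasicHoop.IsFilter F) : Congruence L M where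
  r x y := x ⇨ y ∈ F ∧ y ⇨ x ∈ F
  iseqv := ⟨fun x => by simp [BasicHoop.himp_self, hF.one_mem], fun h => h.symm,
    fun h₁ h₂ => ⟨hF.himp_trans h₁.1 h₂.1, hF.himp_trans h₂.2 h₁.2⟩⟩
  compat {n} f x y h := by
    rcases HoopLang.eq_zero_or_hoop f with rfl | ⟨g, rfl⟩
    · rw [Subsingleton.elim x y]
      simp [BasicHoop.himp_self, hF.one_mem]
    cases g with
    | one => simp [funMap_one, BasicHoop.himp_self, hF.one_mem]
    | inf =>
      rw [funMap_inf, funMap_inf]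
      exact ⟨hF.mem_of_le (hF.mul_mem (h 0).1 (h 1).1) (BasicHoop.himp_mul_himp_inf_le _ _ _ _),
        hF.mem_of_le (hF.mul_mem (h 0).2 (h 1).2) (BasicHoop.himp_mul_himp_inf_le _ _ _ _)⟩
    | sup =>
      rw [funMap_sup, funMap_sup]
      exact ⟨hF.mem_of_le (hF.mul_mem (h 0).1 (h 1).1) (BasicHoop.himp_mul_himp_sup_le _ _ _ _),
        hF.mem_of_le (hF.mul_mem (h 0).2 (h 1).2) (BasicHoop.himp_mul_himp_sup_le _ _ _ _)⟩
    | mul =>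
      rw [funMap_mul, funMap_mul]
      exact ⟨hF.mem_of_le (hF.mul_mem (h 0).1 (h 1).1) (BasicHoop.himp_mul_himp_mul_le _ _ _ _),
        hF.mem_of_le (hF.mul_mem (h 0).2 (h 1).2) (BasicHoop.himp_mul_himp_mul_le _ _ _ _)⟩
    | imp =>
      rw [funMap_imp, funMap_imp]
      exact ⟨hF.mem_of_le (hF.mul_mem (h 0).2 (h 1).1) (BasicHoop.himp_mul_himp_himp_le _ _ _ _),
        hF.mem_of_le (hF.mul_mem (h 0).1 (h 1).2) (BasicHoop.himp_mul_himp_himp_le _ _ _ _)⟩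

theorem filterCongruence_one {F : Set M} (hF : BasicHoop.IsFilter F) {x : M} :
    (filterCongruence L hF).toSetoid x 1 ↔ x ∈ F := by
  change (x ⇨ 1 ∈ F ∧ 1 ⇨ x ∈ F) ↔ x ∈ F
  simp [BasicHoop.himp_one, BasicHoop.one_himp, hF.one_mem]

theorem Congruence.mul {θ : Congruence L M} {x x' y y' : M} (hx : θ.toSetoid x x')
    (hy : θ.toSetoid y y') : θ.toSetoid (x * y) (x' * y') := by
  simpa [funMap_mul] using θ.compat (op L .mul) ![x, y] ![x', y']
    fun i => by fin_cases i <;> assumption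

theorem Congruence.sup {θ : Congruence L M} {x x' y y' : M} (hx : θ.toSetoid x x')
    (hy : θ.toSetoid y y') : θ.toSetoid (x ⊔ y) (x' ⊔ y') := by
  simpa [funMap_sup] using θ.compat (op L .sup) ![x, y] ![x', y']
    fun i => by fin_cases i <;> assumption

theorem Congruence.himp {θ : Congruence L M} {x x' y y' : M} (hx : θ.toSetoid x x')
    (hy : θ.toSetoid y y') : θ.toSetoid (x ⇨ y) (x' ⇨ y') := by
  simpa [funMap_imp] using θ.compat (op L .imp) ![x, y] ![x', y']
    fun i => by fin_cases i <;> assumption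

theorem Congruence.isFilter (θ : Congruence L M) : BasicHoop.IsFilter {x | θ.toSetoid x 1} where
  one_mem := θ.toSetoid.refl 1
  mul_mem {x y} hx hy := by
    simpa using Congruence.mul (L := L) hx hy
  mem_of_le {x y} hx h := by
    have := Congruence.sup (L := L) hx (θ.toSetoid.refl y)
    rwa [sup_eq_right.2 h, sup_eq_left.2 (BasicHoop.le_one y)] at this

theorem Congruence.himp_one {θ : Congruence L M} {x y : M} (h : θ.toSetoid x y) :
    θ.toSetoid (x ⇨ y) 1 := by
  simpa [BasicHoop.himp_self] using Congruence.himp (L := L) h (θ.toSetoid.refl y)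

variable (L) in
/-- The interpretations of the constants. -/
def constants (M : Type u) [L.Structure M] : Set M := Set.range fun c : L.Functions 0 => funMap c ![]

variable (htot : ∀ x y : M, x ≤ y ∨ y ≤ x)

variable (L) in
/-- A union of components of a chain that contains the constants, as a substructure. -/
def componentSubstructure (F : Set M)
    (hF : constants L M ⊆ BasicHoop.inComponents F) : L.Substructure M where
  carrier := BasicHoop.inComponents F
  fun_mem {n} f x hx := by
    rcases HoopLang.eq_zero_or_hoop f with rfl | ⟨g, rfl⟩
    · rw [Subsingleton.elim x (![])]
      exact hF ⟨f, rfl⟩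
    cases g with
    | one => exact Or.inl (funMap_one _)
    | inf =>
      rw [funMap_inf]
      exact BasicHoop.inf_mem_inComponents htot (hx 0) (hx 1)
    | sup =>
      rw [funMap_sup]
      exact BasicHoop.sup_mem_inComponents htot (hx 0) (hx 1)
    | mul =>
      rw [funMap_mul]
      exact BasicHoop.mul_mem_inComponents htot (hx 0) (hx 1)
    | imp =>
      rw [funMap_imp]
      exact BasicHoop.himp_mem_inComponents htot (hx 1)

end Alg

theorem BasicHoop.subset_inComponents {α : Type u} [BasicHoop α] (F : Set α) :
    F ⊆ BasicHoop.inComponents F := fun x hx =>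
  or_iff_not_imp_left.2 fun h => ⟨x, hx, BasicHoop.Same.refl h⟩

theorem hom_mem_inComponents {M N : Type u} [L.Structure M] [L.Structure N] [BasicHoop M]
    [BasicHoop N] [CompatibleHoop L M] [CompatibleHoop L N] {f : M →[L] N}
    (hf : Function.Injective f) {F : Set M} {G : Set N} (hFG : ∀ x ∈ F, f x ∈ G) {x : M}
    (hx : x ∈ BasicHoop.inComponents F) : f x ∈ BasicHoop.inComponents G := by
  rcases hx with rfl | ⟨y, hy, hs⟩
  · exact Or.inl (hom_one f)
  · exact Or.inr ⟨f y, hFG y hy, (hom_same_iff hf).2 hs⟩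

theorem isTotallyOrdered_red_iff {A : Bundled.{u} L.Structure} [BasicHoop A] [CompatibleHoop L A] :
    IsTotallyOrdered (red A) ↔ ∀ x y : A, x ≤ y ∨ y ≤ x := by
  have key : ∀ x y : A, le (M := red A) x y ↔ x ≤ y := by
    intro x y
    rw [← inf_eq_left]
    change funMap (op L .inf) ![x, y] = x ↔ _
    rw [funMap_inf]
    rfl
  exact forall₂_congr fun x y => or_congr (key x y) (key y x)

/-- A hoop with finitely many components. -/
def FinitelyManyComponents (A : Bundled.{u} hoop.Structure) : Prop :=
  ∃ F : Set A, F.Finite ∧ ∀ x : A, x ≠ one → ∃ f ∈ F, f ≠ one ∧ imp (imp x f) f = imp (imp f x) x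

theorem finitelyManyComponents_red_iff {A : Bundled.{u} L.Structure} [BasicHoop A]
    [CompatibleHoop L A] : FinitelyManyComponents (red A) ↔
      ∃ F : Set A, F.Finite ∧ ∀ x, x ≠ 1 → ∃ f ∈ F, BasicHoop.Same x f := by
  have h1 : (one : red A) = (1 : A) := funMap_one (L := L) (M := A) ![]
  have h2 : ∀ x y : A, imp (M := red A) x y = x ⇨ y := fun x y => funMap_imp (L := L) ![x, y]
  have h3 : ∀ x f : A, imp (M := red A) (imp (M := red A) x f) f = (x ⇨ f) ⇨ f := fun x f =>
    (congrArg (fun t => imp (M := red A) t f) (h2 x f)).trans (h2 _ f)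
  refine exists_congr fun F => and_congr_right fun _ => ?_
  rw [h1]
  refine forall₂_congr fun x hx => exists_congr fun f => and_congr_right fun _ => ?_
  exact ⟨fun h => ⟨hx, h.1, (h3 x f).symm.trans (h.2.trans (h3 f x))⟩,
    fun h => ⟨h.2.1, (h3 x f).trans (h.2.2.trans (h3 f x).symm)⟩⟩

/-- The totally ordered members with finitely many components of a class of algebras. -/
def finiteChains (V : Set (Bundled.{u} L.Structure)) : Set (Bundled.{u} L.Structure) :=
  {A | A ∈ V ∧ IsTotallyOrdered (red A) ∧ FinitelyManyComponents (red A)}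

end BLAmalgamation

namespace BLAmalgamation

open CategoryTheory FirstOrder.Language.Structure
open scoped FirstOrder

/-! ### Amalgamation in a variety and in its chains with finitely many components -/

section Amalgamation

open BasicHoop

variable {L : FirstOrder.Language.{0, 0}} [HoopLang L]

theorem IsBasicHoop.exists_instance {A : Bundled.{u} L.Structure} (h : IsBasicHoop (red A)) :
    ∃ _ : BasicHoop A, CompatibleHoop L A :=
  ⟨h.toBasicHoop (A := red A), h.compatibleHoop⟩

variable {V : Set (Bundled.{u} L.Structure)} (hV : IsVariety V)
  (hB : ∀ A ∈ V, IsBasicHoop (red A))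

section

variable {A B C : Bundled.{u} L.Structure} [BasicHoop A] [CompatibleHoop L A] [BasicHoop B]
  [CompatibleHoop L B] [BasicHoop C] [CompatibleHoop L C]

include hV hB in
/-- The quotient by a prime filter is a chain. -/
theorem exists_chain_quotient (hA : A ∈ V) {F : Set A} (hF : IsFilter F)
    (hprime : ∀ x y, x ⇨ y ∈ F ∨ y ⇨ x ∈ F) :
    ∃ (Q : Bundled.{u} L.Structure) (q : A →[L] Q), Q ∈ V ∧ IsTotallyOrdered (red Q) ∧
      Function.Surjective q ∧ ∀ x y, q x = q y ↔ (x ⇨ y ∈ F ∧ y ⇨ x ∈ F) := by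
  let θ := filterCongruence L hF
  have hQ : θ.quotient ∈ V := hV.mem_of_surjective _ hA θ.proj_surjective
  obtain ⟨_, _⟩ := (hB _ hQ).exists_instance
  refine ⟨θ.quotient, θ.proj, hQ, isTotallyOrdered_red_iff.2 ?_, θ.proj_surjective,
    fun x y => θ.proj_eq_proj⟩
  have key : ∀ x y, x ⇨ y ∈ F → θ.proj x ≤ θ.proj y := fun x y h => by
    rw [← himp_eq_one, ← hom_himp, ← hom_one (L := L) θ.proj, θ.proj_eq_proj]
    exact (filterCongruence_one hF).2 h
  intro x y
  obtain ⟨x, rfl⟩ := θ.proj_surjective x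
  obtain ⟨y, rfl⟩ := θ.proj_surjective y
  exact (hprime x y).imp (key x y) (key y x)

theorem eq_one_iff_of_kernel {q : A →[L] B} {F : Set A} (hF : IsFilter F)
    (hq : ∀ x y, q x = q y ↔ (x ⇨ y ∈ F ∧ y ⇨ x ∈ F)) {x : A} : q x = 1 ↔ x ∈ F := by
  rw [← hom_one q, hq]
  simp [himp_one, one_himp, hF.one_mem]

theorem hom_eq_iff_himp {f : A →[L] B} {x y : A} :
    f x = f y ↔ f (x ⇨ y) = 1 ∧ f (y ⇨ x) = 1 := by
  rw [hom_himp, hom_himp, himp_eq_one, himp_eq_one, le_antisymm_iff]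

theorem injective_of_eq_one {f : A →[L] B} (h : ∀ x, f x = 1 → x = 1) : Function.Injective f := by
  intro x y hxy
  rw [hom_eq_iff_himp] at hxy
  exact le_antisymm (himp_eq_one.1 (h _ hxy.1)) (himp_eq_one.1 (h _ hxy.2))

/-- Images of chains with finitely many components have finitely many components. -/
theorem FinitelyManyComponents.of_surjective (htot : ∀ x y : A, x ≤ y ∨ y ≤ x)
    (hA : FinitelyManyComponents (red A)) (q : A →[L] B) (hq : Function.Surjective q) :
    FinitelyManyComponents (red B) := by
  classical
  rw [finitelyManyComponents_red_iff] at hA ⊢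
  obtain ⟨F, hF, hcover⟩ := hA
  -- The given representative `f` may be sent to `1` while other elements of its component survive,
  -- so a surviving one is chosen when there is any.
  let rep : A → A := fun f => if h : ∃ x, Same x f ∧ q x ≠ 1 then h.choose else f
  refine ⟨(q ∘ rep) '' F, hF.image _, fun y hy => ?_⟩
  obtain ⟨x, rfl⟩ := hq y
  obtain ⟨f, hf, hs⟩ := hcover x fun h => hy (by rw [h, hom_one])
  have hex : ∃ x, Same x f ∧ q x ≠ 1 := ⟨x, hs, hy⟩
  have hrep : rep f = hex.choose := dif_pos hex
  refine ⟨q (rep f), ⟨f, hf, rfl⟩, hy, ?_, ?_⟩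
  · rw [hrep]; exact hex.choose_spec.2
  · have h : Same x (rep f) := by
      rw [hrep]; exact hs.trans htot hex.choose_spec.1.symm
    simp only [← hom_himp, h.2.2]

/-- A union of finitely many components has finitely many components. -/
theorem finitelyManyComponents_substructure (S : L.Substructure A) {F : Set A} (hF : F.Finite)
    [BasicHoop S] [CompatibleHoop L S] (hFS : F ⊆ S) (hS : (S : Set A) ⊆ inComponents F) :
    FinitelyManyComponents (red (L := L) ⟨S, inferInstance⟩) := by
  refine (finitelyManyComponents_red_iff (A := ⟨S, inferInstance⟩)).2
    ⟨{x : S | x.1 ∈ F}, hF.preimage Subtype.val_injective.injOn, fun x hx => ?_⟩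
  have hinj : Function.Injective S.subtype.toHom := Subtype.val_injective
  have hx1 : x.1 ≠ 1 := fun h => hx ((hom_eq_one (f := S.subtype.toHom) hinj).1 h)
  obtain ⟨f, hf, hs⟩ := (hS x.2).resolve_left hx1
  exact ⟨⟨f, hFS hf⟩, hf, (hom_same_iff (f := S.subtype.toHom) hinj).1 hs⟩

theorem total_of_injective {f : A →[L] B} (hf : Function.Injective f)
    (htot : ∀ x y : B, x ≤ y ∨ y ≤ x) (x y : A) : x ≤ y ∨ y ≤ x := by
  rw [← hom_le_iff hf, ← hom_le_iff hf]
  exact htot _ _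

include hV hB in
/-- Finite unions of components of a chain that contain the constants belong to `finiteChains`. -/
theorem componentSubstructure_mem (hA : A ∈ V) (htot : ∀ x y : A, x ≤ y ∨ y ≤ x) {F : Set A}
    (hF : F.Finite) (hc : constants L A ⊆ inComponents F) :
    (⟨componentSubstructure L htot F hc, inferInstance⟩ : Bundled.{u} L.Structure) ∈
      finiteChains V := by
  set S := componentSubstructure L htot F hc with hS
  have hmem : (⟨S, inferInstance⟩ : Bundled.{u} L.Structure) ∈ V :=
    hV.mem_of_injective S.subtype.toHom hA Subtype.val_injective
  obtain ⟨i₁, i₂⟩ := (hB _ hmem).exists_instance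
  let _ : BasicHoop S := i₁
  have : CompatibleHoop L S := i₂
  refine ⟨hmem, isTotallyOrdered_red_iff.2 fun x y => ?_,
    finitelyManyComponents_substructure S hF (subset_inComponents F) subset_rfl⟩
  exact total_of_injective (A := ⟨S, inferInstance⟩) (f := S.subtype.toHom)
    Subtype.val_injective htot x y

end

include hV hB in
theorem essentialAmalgamation_finiteChains (h : FirstOrder.Language.Amalgamation V) :
    EssentialAmalgamation (finiteChains V) := by
  intro M N P MN MP hM hN hP hess
  obtain ⟨D, ND, PD, hD, hcomm⟩ := h M N P MN MP hM.1 hN.1 hP.1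
  obtain ⟨_, _⟩ := (hB _ hM.1).exists_instance
  obtain ⟨_, _⟩ := (hB _ hN.1).exists_instance
  obtain ⟨_, _⟩ := (hB _ hP.1).exists_instance
  obtain ⟨_, _⟩ := (hB _ hD).exists_instance
  have hNtot := isTotallyOrdered_red_iff.1 hN.2.1
  -- The avoided set is the image of `N ∖ {1}`, closed under joins because `N` is a chain; avoiding
  -- it keeps `N` embedded in the quotient.
  obtain ⟨F, -, hF, hFS, -, hprime⟩ := exists_maximal_filter
    (S := {d : D | ∃ n : N, n ≠ 1 ∧ ND n = d}) (G := {1})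
    (by
      rintro _ ⟨n, hn, rfl⟩ _ ⟨m, hm, rfl⟩
      refine ⟨n ⊔ m, ?_, hom_sup ND.toHom n m⟩
      rcases hNtot n m with hle | hle
      · rwa [sup_eq_right.2 hle]
      · rwa [sup_eq_left.2 hle])
    isFilter_one
    (by
      rintro _ ⟨n, hn, rfl⟩ h1
      exact hn ((hom_eq_one (f := ND.toHom) ND.injective).1 h1))
  obtain ⟨Q, q, hQ, hQtot, -, hq⟩ := exists_chain_quotient hV hB hD hF hprime
  obtain ⟨_, _⟩ := (hB _ hQ).exists_instance
  have hQtot' := isTotallyOrdered_red_iff.1 hQtot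
  let g : N →[L] Q := q.comp ND.toHom
  let k : P →[L] Q := q.comp PD.toHom
  have hg : Function.Injective g := by
    refine injective_of_eq_one fun n hn => ?_
    by_contra hn1
    exact hFS _ ⟨n, hn1, rfl⟩ ((eq_one_iff_of_kernel hF hq).1 hn)
  have hgk : ∀ m, g (MN m) = k (MP m) := fun m =>
    congrArg q (DFunLike.congr_fun hcomm m)
  -- If `k` identified two points, essentiality would make it identify two points of the image of
  -- `M`, but there `k` agrees with the injective `g`.
  have hk : Function.Injective k := by
    intro x y hxy
    by_contra hne
    obtain ⟨a, b, hab, hab'⟩ := hess (kernel k) ⟨x, y, hne, hxy⟩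
    have h1 : k (MP a) = k (MP b) := hab'
    rw [← hgk, ← hgk] at h1
    exact hab (by rw [MN.injective (hg h1)])
  obtain ⟨F₁, hF₁, hc₁⟩ := finitelyManyComponents_red_iff.1 hN.2.2
  obtain ⟨F₂, hF₂, hc₂⟩ := finitelyManyComponents_red_iff.1 hP.2.2
  let G : Set Q := g '' F₁ ∪ k '' F₂
  have hg' : ∀ n, g n ∈ inComponents G := fun n =>
    hom_mem_inComponents hg (F := F₁) (fun x hx => Or.inl ⟨x, hx, rfl⟩)
      (or_iff_not_imp_left.2 (hc₁ n))
  have hk' : ∀ n, k n ∈ inComponents G := fun n =>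
    hom_mem_inComponents hk (F := F₂) (fun x hx => Or.inr ⟨x, hx, rfl⟩)
      (or_iff_not_imp_left.2 (hc₂ n))
  -- The constants of `Q` already lie in the image of `N`.
  have hconst : constants L Q ⊆ inComponents G := by
    rintro _ ⟨c, rfl⟩
    have := hg' (funMap c ![])
    rwa [g.map_fun, Subsingleton.elim (g ∘ ![]) (![])] at this
  let S := componentSubstructure L hQtot' G hconst
  refine ⟨⟨S, inferInstance⟩, (FirstOrder.Language.Embedding.ofInjective hg).codRestrict S hg',
    (FirstOrder.Language.Embedding.ofInjective hk).codRestrict S hk',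
    componentSubstructure_mem hV hB hQ hQtot' ((hF₁.image _).union (hF₂.image _)) hconst, ?_⟩
  ext m
  exact hgk m

/-! ### From essential amalgamation of finite-index chains to amalgamation in the variety -/

section OneSided

variable (hE : EssentialAmalgamation (finiteChains V))
include hV hB hE

/-- One-sided amalgamation of chains with finitely many components. -/
theorem exists_oneSided_of_mem_finiteChains {A B C : Bundled.{u} L.Structure}
    (hA : A ∈ finiteChains V) (hBm : B ∈ finiteChains V) (hC : C ∈ finiteChains V)
    (f : A →[L] B) (hf : Function.Injective f) (g : A →[L] C) (hg : Function.Injective g) :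
    ∃ (D : Bundled.{u} L.Structure) (h : B →[L] D) (k : C →[L] D),
      D ∈ V ∧ Function.Injective h ∧ ∀ a, h (f a) = k (g a) := by
  obtain ⟨_, _⟩ := (hB _ hA.1).exists_instance
  obtain ⟨_, _⟩ := (hB _ hC.1).exists_instance
  have hAtot := isTotallyOrdered_red_iff.1 hA.2.1
  obtain ⟨F, -, hF, hFS, hmax, hprime⟩ := exists_maximal_filter
    (S := {c : C | ∃ a : A, a ≠ 1 ∧ g a = c}) (G := {1})
    (by
      rintro _ ⟨n, hn, rfl⟩ _ ⟨m, hm, rfl⟩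
      refine ⟨n ⊔ m, ?_, hom_sup g n m⟩
      rcases hAtot n m with hle | hle
      · rwa [sup_eq_right.2 hle]
      · rwa [sup_eq_left.2 hle])
    isFilter_one
    (by
      rintro _ ⟨n, hn, rfl⟩ h1
      exact hn ((hom_eq_one hg).1 h1))
  obtain ⟨P, q, hP, hPtot, hqs, hq⟩ := exists_chain_quotient hV hB hC.1 hF hprime
  obtain ⟨_, _⟩ := (hB _ hP).exists_instance
  have hinj : Function.Injective (q.comp g) := by
    refine injective_of_eq_one fun n hn => ?_
    by_contra hn1
    exact hFS _ ⟨n, hn1, rfl⟩ ((eq_one_iff_of_kernel hF hq).1 hn)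
  -- A nontrivial congruence of the quotient pulls back to a filter of `C` properly containing `F`;
  -- by maximality it contains `g a` for some `a ≠ 1`, so `a` and `1` are identified.
  have hess : IsEssential (FirstOrder.Language.Embedding.ofInjective hinj) := by
    rintro θ ⟨x, y, hne, hxy⟩
    obtain ⟨c, rfl⟩ := hqs x
    obtain ⟨d, rfl⟩ := hqs y
    have hH := (kernel (θ.proj.comp q)).isFilter
    have hmem : ∀ {z}, z ∈ {x | (kernel (θ.proj.comp q)).toSetoid x 1} ↔ θ.toSetoid (q z) 1 := by
      intro z
      rw [← hom_one (L := L) q]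
      exact θ.proj_eq_proj
    have hnot : ¬ {x | (kernel (θ.proj.comp q)).toSetoid x 1} ⊆ F := by
      intro hsub
      refine hne ((hq c d).2 ⟨hsub (hmem.2 ?_), hsub (hmem.2 ?_)⟩)
      · rw [hom_himp]; exact Congruence.himp_one hxy
      · rw [hom_himp]; exact Congruence.himp_one (θ.toSetoid.symm hxy)
    have hle : F ⊆ {x | (kernel (θ.proj.comp q)).toSetoid x 1} := fun z hz => by
      rw [hmem, (eq_one_iff_of_kernel hF hq).2 hz]
    have hex : ∃ s, (∃ a : A, a ≠ 1 ∧ g a = s) ∧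
        s ∈ {x | (kernel (θ.proj.comp q)).toSetoid x 1} := by
      by_contra! hcon
      exact hnot (hmax _ hH hle hcon)
    obtain ⟨_, ⟨a, ha, rfl⟩, hs⟩ := hex
    refine ⟨a, 1, fun h => ha (hinj h), ?_⟩
    have h1 : (FirstOrder.Language.Embedding.ofInjective hinj) (1 : A) = (1 : P) :=
      hom_one (q.comp g)
    rw [h1]
    exact hmem.1 hs
  have hPfin : P ∈ finiteChains V :=
    ⟨hP, hPtot, hC.2.2.of_surjective (isTotallyOrdered_red_iff.1 hC.2.1) q hqs⟩
  obtain ⟨D, h, k, hD, hcomm⟩ := hE A B P (FirstOrder.Language.Embedding.ofInjective hf)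
    (FirstOrder.Language.Embedding.ofInjective hinj) hA hBm hPfin hess
  exact ⟨D, h.toHom, k.toHom.comp q, hD.1, h.injective, fun a => DFunLike.congr_fun hcomm a⟩

/-- One-sided amalgamation of chains. -/
theorem exists_oneSided_of_chain {A B C : Bundled.{u} L.Structure}
    (hA : A ∈ V) (hBm : B ∈ V) (hC : C ∈ V) (hAtot : IsTotallyOrdered (red A))
    (hBtot : IsTotallyOrdered (red B)) (hCtot : IsTotallyOrdered (red C))
    (f : A →[L] B) (hf : Function.Injective f) (g : A →[L] C) (hg : Function.Injective g) :
    ∃ (D : Bundled.{u} L.Structure) (h : B →[L] D) (k : C →[L] D),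
      D ∈ V ∧ Function.Injective h ∧ ∀ a, h (f a) = k (g a) := by
  classical
  obtain ⟨_, _⟩ := (hB _ hA).exists_instance
  obtain ⟨_, _⟩ := (hB _ hBm).exists_instance
  obtain ⟨_, _⟩ := (hB _ hC).exists_instance
  have hA' := isTotallyOrdered_red_iff.1 hAtot
  have hB' := isTotallyOrdered_red_iff.1 hBtot
  have hC' := isTotallyOrdered_red_iff.1 hCtot
  have hconst : ∀ {M : Type u} [L.Structure M] [BasicHoop M] (F : Set M),
      constants L M ⊆ inComponents (F ∪ constants L M) := fun F =>
    Set.subset_union_right.trans (subset_inComponents _)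
  have hfin : ∀ {M : Type u} [L.Structure M] (F : Finset M), (↑F ∪ constants L M).Finite :=
    fun F => F.finite_toSet.union (Set.finite_range _)
  have hmap : ∀ {M N : Type u} [L.Structure M] [L.Structure N] (φ : M →[L] N) (R : Finset M)
      (T : Finset N), ∀ x ∈ ((R : Set M) ∪ constants L M),
        φ x ∈ ((T ∪ R.image φ : Finset N) : Set N) ∪ constants L N := by
    rintro M N _ _ φ R T x (hx | ⟨c, rfl⟩)
    · left; simp only [Finset.coe_union, Finset.coe_image]; exact Or.inr ⟨x, hx, rfl⟩
    · right; exact ⟨c, by simp only [φ.map_fun]; congr 1; exact Subsingleton.elim _ _⟩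
  -- Finite sets of components, ordered by inclusion. The images of the `A`-part are added on the
  -- other two sides so that `f` and `g` restrict to the chosen subalgebras.
  let I := Finset A × Finset B × Finset C
  let SA : I → L.Substructure A := fun i =>
    componentSubstructure L hA' (↑i.1 ∪ constants L A) (hconst _)
  let SB : I → L.Substructure B := fun i =>
    componentSubstructure L hB' (↑(i.2.1 ∪ i.1.image f) ∪ constants L B) (hconst _)
  let SC : I → L.Substructure C := fun i =>
    componentSubstructure L hC' (↑(i.2.2 ∪ i.1.image g) ∪ constants L C) (hconst _)
  have hfS : ∀ i, ∀ a : SA i, f a ∈ SB i := fun i a =>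
    hom_mem_inComponents hf (hmap f i.1 i.2.1) a.2
  have hgS : ∀ i, ∀ a : SA i, g a ∈ SC i := fun i a =>
    hom_mem_inComponents hg (hmap g i.1 i.2.2) a.2
  have hone : ∀ i, ∃ (D : Bundled.{u} L.Structure) (h : SB i →[L] D) (k : SC i →[L] D),
      D ∈ V ∧ Function.Injective h ∧ ∀ a : SA i, h ⟨f a, hfS i a⟩ = k ⟨g a, hgS i a⟩ := by
    intro i
    exact exists_oneSided_of_mem_finiteChains hV hB hE
      (componentSubstructure_mem hV hB hA hA' (hfin _) (hconst _))
      (componentSubstructure_mem hV hB hBm hB' (hfin _) (hconst _))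
      (componentSubstructure_mem hV hB hC hC' (hfin _) (hconst _))
      ((f.comp (SA i).subtype.toHom).codRestrict (SB i) (hfS i))
      (fun x y hxy => Subtype.ext (hf (congrArg Subtype.val hxy)))
      ((g.comp (SA i).subtype.toHom).codRestrict (SC i) (hgS i))
      (fun x y hxy => Subtype.ext (hg (congrArg Subtype.val hxy)))
  choose D h k hD hinj hcomm using hone
  have : ∀ i, Nonempty (D i) := fun i => ⟨funMap (op L .one) ![]⟩
  have hevA : ∀ a, ∀ᶠ i in Filter.atTop, a ∈ SA i := fun a =>
    (Filter.eventually_ge_atTop (({a}, ∅, ∅) : I)).mono fun i hi =>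
      subset_inComponents _ (Or.inl (hi.1 (Finset.mem_singleton_self a)))
  have hevB : ∀ b, ∀ᶠ i in Filter.atTop, b ∈ SB i := fun b =>
    (Filter.eventually_ge_atTop ((∅, {b}, ∅) : I)).mono fun i hi =>
      subset_inComponents _
        (Or.inl (Finset.mem_union_left _ (hi.2.1 (Finset.mem_singleton_self b))))
  have hevC : ∀ c, ∀ᶠ i in Filter.atTop, c ∈ SC i := fun c =>
    (Filter.eventually_ge_atTop ((∅, ∅, {c}) : I)).mono fun i hi =>
      subset_inComponents _
        (Or.inl (Finset.mem_union_left _ (hi.2.2 (Finset.mem_singleton_self c))))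
  obtain ⟨H, hH⟩ := exists_hom_reducedProduct Filter.atTop SB h hevB
  obtain ⟨K, hK⟩ := exists_hom_reducedProduct Filter.atTop SC k hevC
  refine ⟨_, H, K, hV.reducedProduct_mem Filter.atTop hD, fun b b' hbb => ?_, fun a => ?_⟩
  · obtain ⟨x, hx, hx'⟩ := hH b
    obtain ⟨y, hy, hy'⟩ := hH b'
    rw [hx, hy, Congruence.proj_eq_proj] at hbb
    -- Injectivity is tested at a single index where the coordinates agree and both elements are
    -- present.
    obtain ⟨i, hi, hbi, hbi'⟩ :=
      (Filter.Eventually.and hbb ((hevB b).and (hevB b'))).exists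
    have hi : x i = y i := hi
    rw [hx' i hbi, hy' i hbi'] at hi
    exact congrArg Subtype.val (hinj i hi)
  · obtain ⟨x, hx, hx'⟩ := hH (f a)
    obtain ⟨y, hy, hy'⟩ := hK (g a)
    rw [hx, hy, Congruence.proj_eq_proj]
    refine (hevA a).mono fun i hi => ?_
    rw [hx' i (hfS i ⟨a, hi⟩), hy' i (hgS i ⟨a, hi⟩)]
    exact hcomm i ⟨a, hi⟩

/-- Elements of one side of a span can be separated by a commuting pair of homomorphisms. -/
theorem exists_separating {A B C : Bundled.{u} L.Structure} (hA : A ∈ V) (hBm : B ∈ V)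
    (hC : C ∈ V) (f : A →[L] B) (g : A →[L] C)
    (hg : Function.Injective g) (x y : B) (hxy : x ≠ y) :
    ∃ (D : Bundled.{u} L.Structure) (h : B →[L] D) (k : C →[L] D),
      D ∈ V ∧ h x ≠ h y ∧ ∀ a, h (f a) = k (g a) := by
  obtain ⟨_, _⟩ := (hB _ hA).exists_instance
  obtain ⟨_, _⟩ := (hB _ hBm).exists_instance
  obtain ⟨_, _⟩ := (hB _ hC).exists_instance
  wlog hle : ¬ x ≤ y generalizing x y
  · rw [not_not] at hle
    obtain ⟨D, h, k, hD, hne, hcomm⟩ := this y x hxy.symm fun h => hxy (le_antisymm hle h)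
    exact ⟨D, h, k, hD, hne.symm, hcomm⟩
  obtain ⟨F, -, hF, hFS, -, hprime⟩ := exists_maximal_filter (S := {x ⇨ y}) (G := {1})
    (by rintro _ rfl _ rfl; exact sup_idem _) isFilter_one
    (by rintro _ rfl h; exact hle (himp_eq_one.1 h))
  have hFle : ∀ p q, p ⇨ q ∈ F → p ⊔ q ∈ F → q ∈ F := fun p q h h' =>
    hF.mem_of_le (hF.mul_mem h h') 
      (mul_sup_le ((mul_comm _ _).trans_le (mul_himp_le p q)) (mul_le_right _ _))
  -- The trace of `F` on `A` generates a filter of `C`; extending it while avoiding the image of the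
  -- complement of the trace keeps the trace unchanged. That complement is join-closed because `F`
  -- is prime.
  obtain ⟨F', hGF', hF', hFS', -, hprime'⟩ := exists_maximal_filter
    (S := {c : C | ∃ a : A, f a ∉ F ∧ g a = c}) (G := {c : C | ∃ a : A, f a ∈ F ∧ g a ≤ c})
    (by
      rintro _ ⟨a, ha, rfl⟩ _ ⟨b, hb, rfl⟩
      refine ⟨a ⊔ b, fun hab => ?_, hom_sup g a b⟩
      rw [hom_sup] at hab
      rcases hprime (f a) (f b) with h | h
      · exact hb (hFle _ _ h hab)
      · exact ha (hFle _ _ h (by rwa [sup_comm])))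
    ⟨⟨1, by rw [hom_one]; exact hF.one_mem, le_one _⟩,
      by
        rintro c d ⟨a, ha, hac⟩ ⟨b, hb, hbd⟩
        exact ⟨a * b, by rw [hom_mul]; exact hF.mul_mem ha hb,
          by rw [hom_mul]; exact mul_le_mul' hac hbd⟩,
      by
        rintro c d ⟨a, ha, hac⟩ hcd
        exact ⟨a, ha, hac.trans hcd⟩⟩
    (by
      rintro _ ⟨a, ha, rfl⟩ ⟨b, hb, hba⟩
      exact ha (hF.mem_of_le hb (hom_mono f ((hom_le_iff hg).1 hba))))
  have hFF' : ∀ a, g a ∈ F' ↔ f a ∈ F := fun a =>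
    ⟨fun h => by by_contra hcon; exact hFS' _ ⟨a, hcon, rfl⟩ h, fun h => hGF' ⟨a, h, le_rfl⟩⟩
  obtain ⟨B', p, hB', hBtot, -, hp⟩ := exists_chain_quotient hV hB hBm hF hprime
  obtain ⟨C', q, hC', hCtot, -, hq⟩ := exists_chain_quotient hV hB hC hF' hprime'
  have hpq : ∀ a b, p (f a) = p (f b) ↔ q (g a) = q (g b) := fun a b => by
    rw [hp, hq, ← hom_himp, ← hom_himp, ← hom_himp, ← hom_himp, hFF', hFF']
  -- Since `F` and `F'` have the same trace on `A`, both composites have this kernel, and the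
  -- quotient of `A` embeds in both chains.
  let θ := kernel (p.comp f)
  have hA' : θ.quotient ∈ V := hV.mem_of_surjective _ hA θ.proj_surjective
  obtain ⟨f', hf'⟩ := exists_hom_of_surjective θ.proj θ.proj_surjective (p.comp f)
    fun a b hab => θ.proj_eq_proj.1 hab
  obtain ⟨g', hg'⟩ := exists_hom_of_surjective θ.proj θ.proj_surjective (q.comp g)
    fun a b hab => (hpq a b).1 (θ.proj_eq_proj.1 hab)
  have hf'i : Function.Injective f' := by
    intro a b hab
    obtain ⟨a, rfl⟩ := θ.proj_surjective a
    obtain ⟨b, rfl⟩ := θ.proj_surjective b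
    rw [hf', hf'] at hab
    exact θ.proj_eq_proj.2 hab
  have hg'i : Function.Injective g' := by
    intro a b hab
    obtain ⟨a, rfl⟩ := θ.proj_surjective a
    obtain ⟨b, rfl⟩ := θ.proj_surjective b
    rw [hg', hg'] at hab
    exact θ.proj_eq_proj.2 ((hpq a b).2 hab)
  obtain ⟨_, _⟩ := (hB _ hA').exists_instance
  obtain ⟨_, _⟩ := (hB _ hB').exists_instance
  have hAtot : IsTotallyOrdered (red θ.quotient) :=
    isTotallyOrdered_red_iff.2 (total_of_injective hf'i (isTotallyOrdered_red_iff.1 hBtot))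
  obtain ⟨D, h, k, hD, hh, hcomm⟩ := exists_oneSided_of_chain hV hB hE hA' hB' hC' hAtot hBtot
    hCtot f' hf'i g' hg'i
  refine ⟨D, h.comp p, k.comp q, hD, fun heq => ?_, fun a => ?_⟩
  · exact hFS _ rfl ((hp x y).1 (hh heq)).1
  · have := hcomm (θ.proj a)
    rwa [hf', hg'] at this

theorem amalgamation_of_essentialAmalgamation : FirstOrder.Language.Amalgamation V := by
  intro M N P MN MP hM hN hP
  choose D₁ h₁ k₁ hD₁ hne₁ hc₁ using
    exists_separating hV hB hE hM hN hP MN.toHom MP.toHom MP.injective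
  choose D₂ h₂ k₂ hD₂ hne₂ hc₂ using
    exists_separating hV hB hE hM hP hN MP.toHom MN.toHom MN.injective
  -- One commuting square for each pair to be separated in `N` or in `P`; the second kind is used
  -- with the roles of the two sides exchanged.
  let I := {p : N × N // p.1 ≠ p.2} ⊕ {p : P × P // p.1 ≠ p.2}
  let D : I → Bundled.{u} L.Structure :=
    Sum.elim (fun p => D₁ p.1.1 p.1.2 p.2) (fun p => D₂ p.1.1 p.1.2 p.2)
  let H : ∀ i, N →[L] D i := fun i =>
    match i with
    | .inl p => h₁ p.1.1 p.1.2 p.2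
    | .inr p => k₂ p.1.1 p.1.2 p.2
  let K : ∀ i, P →[L] D i := fun i =>
    match i with
    | .inl p => k₁ p.1.1 p.1.2 p.2
    | .inr p => h₂ p.1.1 p.1.2 p.2
  have hH : Function.Injective (productLift H) := fun x y hxy => by
    by_contra hne
    exact hne₁ x y hne (congrFun hxy (.inl ⟨(x, y), hne⟩))
  have hK : Function.Injective (productLift K) := fun x y hxy => by
    by_contra hne
    exact hne₂ x y hne (congrFun hxy (.inr ⟨(x, y), hne⟩))
  refine ⟨product D, FirstOrder.Language.Embedding.ofInjective hH,
    FirstOrder.Language.Embedding.ofInjective hK, hV.product_mem ?_, ?_⟩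
  · rintro (p | p)
    · exact hD₁ _ _ _
    · exact hD₂ _ _ _
  · ext m
    refine funext fun i => ?_
    rcases i with p | p
    · exact hc₁ _ _ p.2 m
    · exact (hc₂ _ _ p.2 m).symm

end OneSided

end Amalgamation

end BLAmalgamation

namespace BLAmalgamation

open CategoryTheory FirstOrder.Language.Structure
open scoped FirstOrder

/-! ### Ordinal sums and components -/

instance : HoopLang hoop where
  incl := FirstOrder.Language.LHom.id hoop
  isAlgebraic _ := inferInstanceAs (IsEmpty Empty)
  finite_constants := 
    have : Subsingleton (hoop.Functions 0) := ⟨fun a b => by cases a; cases b; rfl⟩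
    inferInstance
  eq_zero_or_hoop f := Or.inr ⟨f, rfl⟩

instance : HoopLang bl where
  incl := hoopToBL
  isAlgebraic _ := inferInstanceAs (IsEmpty Empty)
  finite_constants := by
    have : (Set.univ : Set (BLFunc 0)) ⊆ {BLFunc.ofHoop HoopFunc.one, BLFunc.zero} := by
      rintro (_ | _) -
      · rename_i f; cases f; simp
      · simp
    exact Set.finite_univ_iff.1 ((Set.toFinite _).subset this)
  eq_zero_or_hoop f := by
    cases f with
    | ofHoop g => exact Or.inr ⟨g, rfl⟩
    | zero => exact Or.inl rfl

/-! ### Embeddings of hoops -/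

section Embeddings

variable {M N : Type u} [hoop.Structure M] [hoop.Structure N] (f : M ↪[hoop] N)

theorem embedding_binary (g : HoopFunc 2) (x y : M) :
    f (funMap (L := hoop) g ![x, y]) = funMap (L := hoop) g ![f x, f y] := by
  refine (f.map_fun g _).trans ?_
  congr 1; ext i; fin_cases i <;> rfl

theorem embedding_one : f one = one := by
  refine (f.map_fun HoopFunc.one _).trans ?_
  exact congrArg _ (Subsingleton.elim _ _)

theorem embedding_inf (x y : M) : f (inf x y) = inf (f x) (f y) := embedding_binary f .inf x y

theorem embedding_sup (x y : M) : f (sup x y) = sup (f x) (f y) := embedding_binary f .sup x y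

theorem embedding_mul (x y : M) : f (mul x y) = mul (f x) (f y) := embedding_binary f .mul x y

theorem embedding_imp (x y : M) : f (imp x y) = imp (f x) (f y) := embedding_binary f .imp x y

theorem embedding_le_iff (x y : M) : le (f x) (f y) ↔ le x y := by
  rw [le, le, ← embedding_inf, f.injective.eq_iff]

theorem embedding_eq_one_iff (x : M) : f x = one ↔ x = one := by
  rw [← embedding_one f, f.injective.eq_iff]

end Embeddings

theorem IsICRL.of_embedding {M N : Bundled.{u} hoop.Structure} (f : M ↪[hoop] N) (h : IsICRL N) :
    IsICRL M where
  inf_comm x y := f.injective (by simp only [embedding_inf, h.inf_comm (f x)])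
  inf_assoc x y z := f.injective (by simp only [embedding_inf, h.inf_assoc])
  sup_comm x y := f.injective (by simp only [embedding_sup, h.sup_comm (f x)])
  sup_assoc x y z := f.injective (by simp only [embedding_sup, h.sup_assoc])
  inf_sup_self x y := f.injective (by simp only [embedding_inf, embedding_sup, h.inf_sup_self])
  sup_inf_self x y := f.injective (by simp only [embedding_inf, embedding_sup, h.sup_inf_self])
  mul_comm x y := f.injective (by simp only [embedding_mul, h.mul_comm (f x)])
  mul_assoc x y z := f.injective (by simp only [embedding_mul, h.mul_assoc])
  one_mul x := f.injective (by simp only [embedding_mul, embedding_one, h.one_mul])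
  residuation x y z := by
    rw [← embedding_le_iff f, ← embedding_le_iff f, embedding_mul, embedding_imp, h.residuation]
  le_one x := by rw [← embedding_le_iff f, embedding_one]; exact h.le_one _

/-- Within a summand the Wajsberg symmetry relates any two elements, so a single element other than
`1` represents it. -/
theorem IsOrdinalSum.finitelyManyComponents {I : Type} [LinearOrder I] [Finite I]
    {B : I → Bundled.{u} hoop.Structure} {A : Bundled.{u} hoop.Structure}
    {ι : ∀ i, B i ↪[hoop] A} (h : IsOrdinalSum B A ι)
    (hB : ∀ i, ∀ x y : B i, imp (imp x y) y = imp (imp y x) x) : FinitelyManyComponents A := by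
  -- A trivial summand, possible as the first one of a BL-algebra, gets the dummy representative
  -- `one`.
  have hb : ∀ i, ∃ b : B i, ∀ x : B i, x ≠ one → b ≠ one := fun i => by
    by_cases hex : ∃ b : B i, b ≠ one
    · exact ⟨hex.choose, fun _ _ => hex.choose_spec⟩
    · exact ⟨one, fun x hx => (hex ⟨x, hx⟩).elim⟩
  choose b hb using hb
  refine ⟨Set.range fun i => ι i (b i), Set.finite_range _, fun a ha => ?_⟩
  obtain ⟨i, x, rfl⟩ := (h.cover a).resolve_left ha
  refine ⟨_, ⟨i, rfl⟩, ?_, ?_⟩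
  · rw [Ne, embedding_eq_one_iff] at ha ⊢
    exact hb i x ha
  · simp only [← embedding_imp, hB i x]

/-! ### Listing the components of a chain in increasing order -/

namespace BasicHoop

variable {α : Type u} [BasicHoop α] (htot : ∀ x y : α, x ≤ y ∨ y ≤ x)
include htot

/-- Representatives of finitely many components can be listed in increasing order. -/
theorem exists_representatives {F : Set α} (hF : F.Finite)
    (hcover : ∀ x, x ≠ 1 → ∃ f ∈ F, Same x f) :
    ∃ (n : ℕ) (c : Fin n → α), (∀ i, c i ≠ 1) ∧ (∀ x, x ≠ 1 → ∃ i, Same x (c i)) ∧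
      ∀ i j, i < j → c i ≤ c j ∧ ¬ Same (c i) (c j) := by
  classical
  let s : Setoid α :=
    { r := fun x y => x = y ∨ Same x y
      iseqv := ⟨fun x => Or.inl rfl, fun h => h.imp Eq.symm Same.symm, by
        rintro x y z (rfl | h) (rfl | h')
        exacts [Or.inl rfl, Or.inr h', Or.inr h, Or.inr (h.trans htot h')]⟩ }
  let rep : α → α := fun x => (Quotient.mk s x).out
  have hrep : ∀ x, x ≠ 1 → Same x (rep x) := fun x hx => by
    have h : rep x = x ∨ Same (rep x) x := Quotient.mk_out (s := s) x
    rcases h with h | h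
    · rw [h]; exact Same.refl hx
    · exact h.symm
  have hrep' : ∀ x y, Same x y → rep x = rep y := fun x y h => by
    have : Quotient.mk s x = Quotient.mk s y := Quotient.sound (Or.inr h)
    simp only [rep, this]
  -- Passing to canonical representatives removes repetitions, so sorting them lists each component
  -- exactly once.
  have hG : (rep '' (F \ {1})).Finite := (hF.subset Set.sdiff_subset).image _
  let _ : LinearOrder α :=
    { (inferInstance : PartialOrder α) with
      le_total := htot
      min_def := fun a b => by
        split_ifs with h
        exacts [inf_eq_left.2 h, inf_eq_right.2 ((htot a b).resolve_left h)]
      max_def := fun a b => by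
        split_ifs with h
        exacts [sup_eq_right.2 h, sup_eq_left.2 ((htot a b).resolve_left h)]
      toDecidableLE := Classical.decRel _ }
  let e := hG.toFinset.orderEmbOfFin rfl
  have he : ∀ i, ∃ f, f ≠ 1 ∧ e i = rep f := fun i => by
    have := hG.toFinset.orderEmbOfFin_mem rfl i
    rw [Set.Finite.mem_toFinset] at this
    obtain ⟨f, hf, h⟩ := this
    exact ⟨f, hf.2, h.symm⟩
  refine ⟨_, e, fun i => ?_, fun x hx => ?_, fun i j hij => ⟨e.monotone hij.le, fun hs => ?_⟩⟩
  · obtain ⟨f, hf, h⟩ := he i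
    rw [h]
    exact (hrep f hf).2.1
  · obtain ⟨f, hf, hs⟩ := hcover x hx
    have hmem : rep f ∈ hG.toFinset := hG.mem_toFinset.2 ⟨f, ⟨hf, hs.2.1⟩, rfl⟩
    have hrange : rep f ∈ Set.range e := by
      rw [Finset.range_orderEmbOfFin]; exact hmem
    obtain ⟨i, hi⟩ := hrange
    exact ⟨i, by rw [hi]; exact hs.trans htot (hrep f hs.2.1)⟩
  · obtain ⟨f, hf, h⟩ := he i
    obtain ⟨g, hg, h'⟩ := he j
    rw [h, h'] at hs
    have : rep f = rep g :=
      hrep' _ _ (((hrep f hf).trans htot hs).trans htot (hrep g hg).symm)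
    exact hij.ne (e.injective (by rw [h, h', this]))

/-- If `y ≤ x` held, then either `y ≤ c ≤ d` or `c ≤ y ≤ x`; convexity of components would then put
`c` and `d` in the same one. -/
theorem below_of_representatives {x y c d : α} (hcd : c ≤ d) (hns : ¬ Same c d) (hx : Same x c)
    (hy : y = 1 ∨ Same y d) : Below x y := by
  rcases hy with rfl | hy
  · exact ⟨le_one x, one_himp x⟩
  have hnot : ¬ Same x y := fun h => hns ((hx.symm.trans htot h).trans htot hy)
  refine below_of_not_same htot hx.1 ((htot x y).resolve_right fun hyx => ?_) hnot
  rcases htot y c with h | h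
  · exact hns (((hy.of_le_of_le htot h hcd).symm).trans htot hy)
  · exact hns (((hx.symm).of_le_of_le htot h hyx).trans htot hy)

end BasicHoop

open BasicHoop CompatibleHoop in
/-- A chain with finitely many components is the ordinal sum of its components. -/
theorem FinitelyManyComponents.hoopFiniteIndex {A : Bundled.{u} hoop.Structure}
    (hA : IsBasicHoop A) (htot : IsTotallyOrdered A) (h : FinitelyManyComponents A) :
    HoopFiniteIndex A := by
  obtain ⟨_, _⟩ := IsBasicHoop.exists_instance (L := hoop) hA
  have ht : ∀ x y : A, x ≤ y ∨ y ≤ x := isTotallyOrdered_red_iff.1 htot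
  obtain ⟨F, hF, hcover⟩ := (finitelyManyComponents_red_iff (A := A)).1 h
  obtain ⟨n, c, hc1, hc, hlt⟩ := exists_representatives ht hF hcover
  have r_one : (one : A) = 1 := funMap_one (L := hoop) (M := A) ![]
  have r_inf : ∀ x y : A, inf x y = x ⊓ y := fun x y => funMap_inf (L := hoop) ![x, y]
  have r_sup : ∀ x y : A, sup x y = x ⊔ y := fun x y => funMap_sup (L := hoop) ![x, y]
  have r_mul : ∀ x y : A, mul x y = x * y := fun x y => funMap_mul (L := hoop) ![x, y]
  have r_imp : ∀ x y : A, imp x y = x ⇨ y := fun x y => funMap_imp (L := hoop) ![x, y]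
  have hconst : ∀ G : Set A, constants hoop A ⊆ inComponents G := by
    rintro G _ ⟨f, rfl⟩
    cases f
    exact Or.inl r_one
  let S : Fin n → hoop.Substructure A := fun i =>
    componentSubstructure hoop ht {c i} (hconst _)
  let B : Fin n → Bundled.{u} hoop.Structure := fun i => ⟨S i, inferInstance⟩
  let ι : ∀ i, B i ↪[hoop] A := fun i => (S i).subtype
  have hS : ∀ i (x : B i), ι i x = 1 ∨ Same (ι i x) (c i) := by
    rintro i ⟨x, hx | ⟨_, rfl, hs⟩⟩
    · exact Or.inl hx
    · exact Or.inr hs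
  have hS' : ∀ i (x : B i), x ≠ one → Same (ι i x) (c i) := fun i x hx =>
    (hS i x).resolve_left fun h => hx ((embedding_eq_one_iff (ι i) x).1 (h.trans r_one.symm))
  have hbelow : ∀ i j, i < j → ∀ (x : B i) (y : B j), x ≠ one → Below (ι i x) (ι j y) :=
    fun i j hij x y hx =>
      below_of_representatives ht (hlt i j hij).1 (hlt i j hij).2 (hS' i x hx) (hS j y)
  refine ⟨Fin n, inferInstance, inferInstance, B, ι, ?_, fun i => ⟨?_, ?_, ?_⟩⟩
  · constructor
    · intro a
      by_cases ha : a = 1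
      · exact Or.inl (ha.trans r_one.symm)
      · obtain ⟨i, hi⟩ := hc a ha
        exact Or.inr ⟨i, ⟨a, Or.inr ⟨c i, rfl, hi⟩⟩, rfl⟩
    · intro i j hij x y hxy
      by_contra hne
      rw [r_one] at hne
      have h1 := (hS i x).resolve_left hne
      have h2 := (hS j y).resolve_left (by rwa [← hxy])
      rw [hxy] at h1
      rcases lt_or_gt_of_ne hij with hlt' | hlt'
      · exact (hlt i j hlt').2 (h1.symm.trans ht h2)
      · exact (hlt j i hlt').2 (h2.symm.trans ht h1)
    all_goals intro i j hij x y hx; have hb := hbelow i j hij x y hx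
    · rw [r_inf, inf_eq_left.2 hb.1]
    · rw [r_inf, inf_eq_right.2 hb.1]
    · rw [r_sup, sup_eq_right.2 hb.1]
    · rw [r_sup, sup_eq_left.2 hb.1]
    · rw [r_mul, mul_comm, hb.mul_eq]
    · rw [r_mul, hb.mul_eq]
    · rw [r_imp, r_one, himp_eq_one.2 hb.1]
    · rw [r_imp, hb.2]
  · refine ⟨hA.toIsICRL.of_embedding (ι i), fun x y => (ι i).injective ?_⟩
    rw [embedding_sup, embedding_imp, embedding_imp, r_sup, r_imp, r_imp]
    generalize hu : ι i x = u
    generalize hv : ι i y = v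
    have hu' := hu ▸ hS i x
    have hv' := hv ▸ hS i y
    rcases hu' with rfl | hu'
    · rw [one_himp, BasicHoop.himp_self, sup_eq_left.2 (le_one v)]
    rcases hv' with rfl | hv'
    · rw [himp_one, sup_eq_right.2 (le_one u)]
    rcases ht u v with hle | hle
    · rw [himp_eq_one.2 hle, one_himp, sup_eq_right.2 hle]
    · rw [sup_eq_left.2 hle, (hu'.trans ht hv'.symm).2.2, himp_eq_one.2 hle, one_himp]
  · intro x y
    rw [← embedding_le_iff (ι i), ← embedding_le_iff (ι i)]
    exact htot _ _
  · refine ⟨⟨⟨c i, Or.inr ⟨c i, rfl, Same.refl (hc1 i)⟩⟩, ⟨1, Or.inl rfl⟩, fun h => ?_⟩⟩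
    exact hc1 i (congrArg Subtype.val h)

theorem hoopFC_eq {V : Set (Bundled.{u} hoop.Structure)} (hB : ∀ A ∈ V, IsBasicHoop A) :
    hoopFC V = finiteChains V := by
  ext A
  refine and_congr_right fun hA => and_congr_right fun htot => ⟨?_, fun h =>
    FinitelyManyComponents.hoopFiniteIndex (hB A hA) htot h⟩
  rintro ⟨I, _, _, B, ι, h, hW⟩
  exact h.finitelyManyComponents fun i x y => by
    rw [(hW i).1.wajsberg, (hW i).1.wajsberg, (hW i).1.sup_comm]

theorem isMVAlgebra_withZero {M : Bundled.{u} hoop.Structure} {z : M} (h : IsWajsbergHoop M)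
    (hz : ∀ x, le z x) : IsMVAlgebra (withZero M z) where
  inf_comm := h.inf_comm
  inf_assoc := h.inf_assoc
  sup_comm := h.sup_comm
  sup_assoc := h.sup_assoc
  inf_sup_self := h.inf_sup_self
  sup_inf_self := h.sup_inf_self
  mul_comm := h.mul_comm
  mul_assoc := h.mul_assoc
  one_mul := h.one_mul
  residuation := h.residuation
  le_one := h.le_one
  wajsberg := h.wajsberg
  zero_le := hz

theorem HoopFiniteIndex.blFiniteIndex {A : Bundled.{u} bl.Structure} (hA : IsBLAlgebra A)
    (htot : IsTotallyOrdered (reduct A)) (h : HoopFiniteIndex (reduct A)) : BLFiniteIndex A := by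
  -- When `0 = 1` the algebra is trivial and has no nontrivial component to serve as the first one,
  -- so the algebra itself is taken as the only summand.
  by_cases h01 : zero A = one
  · have hsub : ∀ x : reduct A, x = one := fun x => by
      have h1 : inf (zero A) x = zero A := hA.zero_le x
      have h2 : inf x one = x := hA.le_one x
      rw [h01, hA.inf_comm, h2] at h1
      exact h1
    have hsub' : ∀ x y : reduct A, x = y := fun x y => (hsub x).trans (hsub y).symm
    refine ⟨Unit, inferInstance, inferInstance, fun _ => reduct A,
      fun _ => FirstOrder.Language.Embedding.refl hoop (reduct A), (), zero A, ?_,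
      fun _ => le_rfl, isMVAlgebra_withZero ⟨hA.toIsICRL, fun _ _ => hsub' _ _⟩ hA.zero_le,
      htot, rfl, fun i hi => (hi rfl).elim⟩
    constructor
    · exact fun a => Or.inl (hsub a)
    · exact fun _ _ _ _ _ _ => hsub _
    all_goals exact fun _ _ _ _ _ _ => hsub' _ _
  obtain ⟨I, _, _, B, ι, hsum, hW⟩ := h
  obtain ⟨i, z, hz⟩ := (hsum.cover (zero A)).resolve_left h01
  have hz1 : z ≠ one := fun h => h01 (by rw [← hz, h, embedding_one])
  refine ⟨I, inferInstance, inferInstance, B, ι, i, z, hsum, fun j => ?_,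
    isMVAlgebra_withZero (hW i).1 fun x => ?_, (hW i).2.1, hz, fun j _ => hW j⟩
  -- The component of `0` comes first: an element `y ≠ 1` of an earlier one would be both below and
  -- above `0`, hence equal to it, against disjointness.
  · by_contra hji
    rw [not_le] at hji
    have := (hW j).2.2
    obtain ⟨y, hy⟩ := exists_ne (one : B j)
    have h1 : inf (ι j y) (ι i z) = ι j y := hsum.inf_lt j i hji y z hy
    have h2 : inf (ι i z) (ι j y) = ι i z := by rw [hz]; exact hA.zero_le _
    rw [hA.inf_comm, h2] at h1
    exact hz1 ((embedding_eq_one_iff _ _).1 (hsum.disjoint i j hji.ne' z y h1))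
  · rw [← embedding_le_iff (ι i), hz]
    exact hA.zero_le _

theorem blFC_eq {V : Set (Bundled.{u} bl.Structure)} (hB : ∀ A ∈ V, IsBLAlgebra A) :
    blFC V = finiteChains V := by
  ext A
  refine and_congr_right fun hA => and_congr_right fun htot => ⟨?_, fun h =>
    (FinitelyManyComponents.hoopFiniteIndex (hB A hA).toIsBasicHoop htot h).blFiniteIndex
      (hB A hA) htot⟩
  rintro ⟨I, _, _, B, ι, i₀, z, h, -, hMV, -, -, hW⟩
  refine h.finitelyManyComponents fun i x y => ?_
  by_cases hi : i = i₀
  · subst hi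
    exact (hMV.wajsberg x y).trans ((hMV.sup_comm x y).trans (hMV.wajsberg y x).symm)
  · rw [(hW i hi).1.wajsberg, (hW i hi).1.wajsberg, (hW i hi).1.sup_comm]

end BLAmalgamation

theorem corollary3p6 :
    (∀ V : Set (CategoryTheory.Bundled.{u} BLAmalgamation.hoop.Structure),
      BLAmalgamation.IsVariety V → (∀ A ∈ V, BLAmalgamation.IsBasicHoop A) →
        (FirstOrder.Language.Amalgamation V ↔
          BLAmalgamation.EssentialAmalgamation (BLAmalgamation.hoopFC V))) ∧
    (∀ V : Set (CategoryTheory.Bundled.{u} BLAmalgamation.bl.Structure),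
      BLAmalgamation.IsVariety V → (∀ A ∈ V, BLAmalgamation.IsBLAlgebra A) →
        (FirstOrder.Language.Amalgamation V ↔
          BLAmalgamation.EssentialAmalgamation (BLAmalgamation.blFC V))) := by
  refine ⟨fun V hV hB => ?_, fun V hV hB => ?_⟩
  · rw [BLAmalgamation.hoopFC_eq hB]
    exact ⟨BLAmalgamation.essentialAmalgamation_finiteChains hV hB,
      BLAmalgamation.amalgamation_of_essentialAmalgamation hV hB⟩
  · rw [BLAmalgamation.blFC_eq hB]
    have hB' := fun A hA => (hB A hA).toIsBasicHoop
    exact ⟨BLAmalgamation.essentialAmalgamation_finiteChains hV hB',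
      BLAmalgamation.amalgamation_of_essentialAmalgamation hV hB'⟩
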